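/- Let $0<b_-<b_+<\infty$, $r:=b_+/b_-$ and $\epsilon>0$. Let $b(x):=b_\pm$ for $\pm x>0$, and let $b_\epsilon\in L^1_{\rm loc}(\mathbb{R})$ be real-valued with $b_\epsilon(x)=b_\pm$ for almost every $x$ with $\pm x>\epsilon$, and $b_-\le b_\epsilon(x)\le b_+$ for almost every $x$ with $|x|\le\epsilon$. Put $\beta(x):=\int_0^x b(s)\,ds$ and $\beta_\epsilon(x):=\int_0^x b_\epsilon(s)\,ds$. For $k\in\mathbb{R}$ let $\omega_1(k)\le\omega_2(k)\le\cdots$ and $\omega_{\epsilon,1}(k)\le\omega_{\epsilon,2}(k)\le\cdots$ be the eigenvalues, in increasing order and counted with multiplicity, of the self-adjoint operators $$h(k)=-\frac{d^2}{dx^2}+(k-\beta(x))^2\quad\text{and}\quad h_\epsilon(k)=-\frac{d^2}{dx^2}+(k-\beta_\epsilon(x))^2$$ in $L^2(\mathbb{R})$, each with domain the set of all $u\in L^2(\mathbb{R})$ whose image, in the sense of distributions, lies in $L^2(\mathbb{R})$. Then, for every integer $j\ge1$ and every $k\in\mathbb{R}$, $$|\omega_{\epsilon,j}(k)-\omega_j(k)|\le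 (r-1)(b_-^{1/2}\epsilon)\left((r-1)(b_-^{1/2}\epsilon)+2(2j-1)^{1/2}r^{1/2}\right)b_- .$$ -/

import Mathlib

open MeasureTheory
open scoped ContDiff

noncomputable section

/-- The complex Hilbert space `L²(ℝ)`. -/
abbrev L2R : Type := Lp ℂ 2 (volume : Measure ℝ)

/-- A continuous function with compact support times a function in `L²(ℝ)` is integrable. -/
theorem integrable_smul_L2R {g : ℝ → ℝ} (hg : Continuous g) (hs : HasCompactSupport g)
    (u : L2R) : Integrable (fun x => g x • u x) volume := by
  have h := (Lp.memLp u).locallyIntegrable (by norm_num)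
  exact h.integrable_smul_left_of_hasCompactSupport hg hs

/-- The differential expression `-φ'' + V φ` is continuous for a smooth `φ`. -/
theorem continuous_schrodinger_test (V : C(ℝ, ℝ)) {φ : ℝ → ℝ} (hφ : ContDiff ℝ ∞ φ) :
    Continuous (fun x => -(deriv (deriv φ) x) + V x * φ x) := by
  have h1 : ContDiff ℝ ∞ (deriv φ) := (contDiff_infty_iff_deriv.1 hφ).2
  have h2 : ContDiff ℝ ∞ (deriv (deriv φ)) := (contDiff_infty_iff_deriv.1 h1).2
  exact h2.continuous.neg.add (V.continuous.mul hφ.continuous)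

theorem hasCompactSupport_schrodinger_test (V : C(ℝ, ℝ)) {φ : ℝ → ℝ}
    (hs : HasCompactSupport φ) :
    HasCompactSupport (fun x => -(deriv (deriv φ) x) + V x * φ x) :=
  hs.deriv.deriv.neg.add (hs.mul_left (f := fun x => V x))

/-- The graph of `-d²/dx² + V` in `L²(ℝ)`: the pairs `(u, f)` of elements of `L²(ℝ)` with
`-u'' + V u = f` in the sense of distributions, i.e. tested against real `φ ∈ C₀^∞(ℝ)`. -/
def schrodingerGraph (V : C(ℝ, ℝ)) : Submodule ℂ (L2R × L2R) where
  carrier := {p | ∀ φ : ℝ → ℝ, ContDiff ℝ ∞ φ → HasCompactSupport φ →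
    ∫ x, (-(deriv (deriv φ) x) + V x * φ x) • p.1 x = ∫ x, φ x • p.2 x}
  zero_mem' := by
    intro φ _ _
    have h0 : ((0 : L2R) : ℝ → ℂ) =ᵐ[volume] 0 := Lp.coeFn_zero _ _ _
    have h (g : ℝ → ℝ) : ∫ x, g x • (0 : L2R) x = 0 := by
      rw [integral_eq_zero_of_ae]
      filter_upwards [h0] with x hx
      simp
    exact (h _).trans (h _).symm
  add_mem' := by
    intro p q hp hq φ hφ hs
    have h {g : ℝ → ℝ} (hg : Continuous g) (hc : HasCompactSupport g) (u v : L2R) :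
        ∫ x, g x • (u + v) x = (∫ x, g x • u x) + ∫ x, g x • v x := by
      rw [← integral_add (integrable_smul_L2R hg hc u) (integrable_smul_L2R hg hc v)]
      refine integral_congr_ae ?_
      filter_upwards [Lp.coeFn_add u v] with x hx
      rw [hx, Pi.add_apply, smul_add]
    have e1 := h (continuous_schrodinger_test V hφ)
      (hasCompactSupport_schrodinger_test V hs) p.1 q.1
    have e2 := h hφ.continuous hs p.2 q.2
    have e3 := hp φ hφ hs
    have e4 := hq φ hφ hs
    rw [Prod.fst_add, Prod.snd_add, e1, e2, e3, e4]
  smul_mem' := by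
    intro c p hp φ hφ hs
    have h (g : ℝ → ℝ) (u : L2R) : ∫ x, g x • (c • u) x = c * ∫ x, g x • u x := by
      rw [← integral_const_mul]
      refine integral_congr_ae ?_
      filter_upwards [Lp.coeFn_smul c u] with x hx
      rw [hx, Pi.smul_apply, smul_eq_mul, mul_smul_comm]
    have e3 := hp φ hφ hs
    change ∫ x, _ • (c • p.1) x = ∫ x, φ x • (c • p.2) x
    rw [h, h, e3]

/-- The graph is the graph of a (single-valued) operator. -/
theorem schrodingerGraph_single_valued (V : C(ℝ, ℝ)) :
    ∀ p : L2R × L2R, p ∈ schrodingerGraph V → p.1 = 0 → p.2 = 0 := by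
  rintro ⟨u, f⟩ hp hu
  obtain rfl : u = 0 := hu
  have h0 : ((0 : L2R) : ℝ → ℂ) =ᵐ[volume] 0 := Lp.coeFn_zero _ _ _
  have h := ae_eq_zero_of_integral_contDiff_smul_eq_zero
    ((Lp.memLp f).locallyIntegrable (by norm_num)) (fun g hg hs => by
      rw [← hp g hg hs]
      rw [integral_eq_zero_of_ae]
      filter_upwards [h0] with x hx
      simp [hx])
  exact (Lp.eq_zero_iff_ae_eq_zero).2 h

/-- The operator `-d²/dx² + V` in `L²(ℝ)` on its maximal domain
`{u ∈ L²(ℝ) : -u'' + V u ∈ L²(ℝ)}`, i.e. the adjoint of its restriction to `C₀^∞(ℝ)`. For `V ≥ 0`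
that restriction is essentially self-adjoint, and this is the self-adjoint operator it defines. -/
def schrodingerOp (V : C(ℝ, ℝ)) : L2R →ₗ.[ℂ] L2R :=
  (schrodingerGraph V).toLinearPMap

theorem schrodingerOp_graph (V : C(ℝ, ℝ)) : (schrodingerOp V).graph = schrodingerGraph V :=
  Submodule.toLinearPMap_graph_eq _ (schrodingerGraph_single_valued V)

/-- The `j`-th eigenvalue (`j = 1, 2, …`, in increasing order and counted with multiplicity) of an
operator in `L²(ℝ)`: the least `E` such that there are at least `j` linearly independent
eigenvectors with real eigenvalues at most `E`. -/
def nthEigenvalue (T : L2R →ₗ.[ℂ] L2R) (j : ℕ) : ℝ :=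
  sInf {E : ℝ | ∃ v : Fin j → L2R, LinearIndependent ℂ v ∧
    ∀ i, ∃ μ : ℝ, μ ≤ E ∧ ∃ hv : v i ∈ T.domain, T ⟨v i, hv⟩ = (μ : ℂ) • v i}

/-- The potential `β(x) = ∫₀ˣ b(s) ds` of a locally integrable magnetic field `b`. -/
def vectorPotential (b : ℝ → ℝ) (hb : LocallyIntegrable b volume) : C(ℝ, ℝ) where
  toFun := fun x => ∫ s in (0 : ℝ)..x, b s
  continuous_toFun :=
    intervalIntegral.continuous_primitive (fun _ _ =>
      (hb.integrableOn_isCompact isCompact_uIcc).intervalIntegrable) 0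

/-- The fiber operator `h(k) = -d²/dx² + (k - β(x))²` in `L²(ℝ)` for the magnetic field `b`. -/
def fiberOp (b : ℝ → ℝ) (hb : LocallyIntegrable b volume) (k : ℝ) : L2R →ₗ.[ℂ] L2R :=
  schrodingerOp ((ContinuousMap.const ℝ k - vectorPotential b hb) ^ 2)

/-- The band function `k ↦ ω_j(k)`, `j = 1, 2, …`, for the magnetic field `b`. -/
def bandFunction (b : ℝ → ℝ) (hb : LocallyIntegrable b volume) (j : ℕ) (k : ℝ) : ℝ :=
  nthEigenvalue (fiberOp b hb k) j

/-- The sharp magnetic field: `b₋` on the left half-line and `b₊` on the right half-line. -/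
def sharpField (bm bp : ℝ) : ℝ → ℝ := fun x => if x < 0 then bm else bp

theorem locallyIntegrable_sharpField (bm bp : ℝ) :
    LocallyIntegrable (sharpField bm bp) volume := by
  have h : sharpField bm bp
      = fun x => (Set.Iio (0 : ℝ)).indicator (fun _ => bm - bp) x + bp := by
    funext x
    by_cases hx : x < 0 <;> simp [sharpField, hx]
  rw [h]
  exact ((locallyIntegrable_const (bm - bp)).indicator measurableSet_Iio).add
    (locallyIntegrable_const bp)

/-- The condition on a (locally integrable) smoothed magnetic field: it equals `b₋` to the left of
`-ε` and `b₊` to the right of `ε`, and takes values in `[b₋, b₊]` in between, almost everywhere. -/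
def IsSmoothedField (bm bp ε : ℝ) (b : ℝ → ℝ) : Prop :=
  (∀ᵐ x, x < -ε → b x = bm) ∧ (∀ᵐ x, ε < x → b x = bp) ∧
    ∀ᵐ x, |x| ≤ ε → bm ≤ b x ∧ b x ≤ bp

end

/-! Write a = k - β and a' = k - β_ε, so that the operators are -d²/dx² + a² and -d²/dx² + a'². The
two fields differ only on [-ε, ε], and there by at most b₊ - b₋; hence |a' - a| ≤ δ := (b₊ - b₋) ε
everywhere. The potentials a² and a'² may differ by an unbounded amount, so the comparison is made
at the level of quadratic forms. If ‖u'‖² + ‖a u‖² ≤ E ‖u‖², then ‖a u‖ ≤ √E ‖u‖, and ‖a' u‖ ≤ ‖a u‖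
+ δ ‖u‖ gives the form bound E + 2 δ √E + δ² for a' (`HasTrialSpace.perturb`). Min-max turns this
into a bound between j-th eigenvalues, with √E replaced by √B for any a priori bound B
(`nthEigenvalue_le_perturb`). Exchanging the fields gives the other sign.

For B, choose c with β(c) = k. Then |a(x)| ≤ b₊ |x - c|, and polynomials of degree below j times a
Gaussian centred at c give B = (2j - 1) b₊, uniformly in k (`hasTrialSpace_oscillator`). This rests
on a sharp Bernstein inequality with Gaussian weight (`gaussianNormSq_derivative_le`).

Min-max has to be linked to an operator defined by distributions on its maximal domain. Let J be the
embedding of the form domain in L². Then J J† is the resolvent (H + 1)⁻¹: Riesz duality shows that J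
J† f solves the equation, and solutions are unique because -1 is not an eigenvalue
(`eq_zero_of_mem_schrodingerGraph_neg`). Eigenvectors of H thus correspond to those of J† J, with l
= 1/(μ + 1). Since |a| → ∞, J is compact, and the max-min principle for J† J shows that E admits a
j-dimensional trial space exactly when it admits j independent eigenvectors with eigenvalues at most
E (`nthEigenvalue_eq_sInf`). -/

/-! ### Max-min principle for `J† J` with `J` compact. -/

section AbstractMinMax

variable {X L : Type*} [NormedAddCommGroup X] [InnerProductSpace ℂ X] [CompleteSpace X]
  [NormedAddCommGroup L] [InnerProductSpace ℂ L] [CompleteSpace L]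

open ContinuousLinearMap in
/-- The norm of a nonzero positive compact operator is an eigenvalue. -/
theorem exists_hasEigenvalue_of_compact_of_nonneg {S : X →L[ℂ] X} (hc : IsCompactOperator S)
    (hs : S.IsSymmetric) (hpos : ∀ x, 0 ≤ S.reApplyInnerSelf x) {c : ℝ} (hc0 : 0 < c) {x : X}
    (hx : x ≠ 0) (hcx : c * ‖x‖ ^ 2 ≤ S.reApplyInnerSelf x) :
    ∃ l : ℝ, c ≤ l ∧ ∃ v : X, v ≠ 0 ∧ S v = (l : ℂ) • v := by
  have : Nontrivial X := ⟨x, 0, hx⟩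
  have hxn : 0 < ‖x‖ ^ 2 := by positivity
  have h1 : c ≤ S.rayleighQuotient x := by
    rw [rayleighQuotient, le_div_iff₀ hxn]; exact hcx
  have h2 : c ≤ ‖S‖ := h1.trans ((le_abs_self _).trans (S.rayleighQuotient_le_norm x))
  refine ⟨‖S‖, h2, ?_⟩
  have hne : (‖S‖ : ℂ) ≠ 0 := by exact_mod_cast (hc0.trans_le h2).ne'
  have hspec : (‖S‖ : ℂ) ∈ spectrum ℂ S := by
    by_contra hcon
    have hr : algebraMap ℝ ℂ ‖S‖ ∈ resolventSet ℂ S := by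
      simpa [spectrum] using hcon
    -- If ‖S‖ were in the resolvent set, the Rayleigh quotients would stay below ‖S‖ by a fixed gap,
    -- while their supremum in modulus is ‖S‖ by symmetry.
    obtain ⟨e, he, h⟩ := S.rayleighQuotient_le_of_norm_mem_resolventSet hr
    have h3 := S.norm_eq_iSup_rayleighQuotient hs
    have h4 : ⨆ x, |S.rayleighQuotient x| ≤ ‖S‖ - e := by
      refine ciSup_le fun y => ?_
      rw [abs_of_nonneg (div_nonneg (hpos y) (by positivity))]
      exact h y
    linarith
  have := (hc.hasEigenvalue_iff_mem_spectrum hne).2 hspec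
  obtain ⟨v, hv⟩ := this.exists_hasEigenvector
  exact ⟨v, hv.2, hv.apply_eq_smul⟩

theorem adjoint_comp_self_isSymmetric (J : X →L[ℂ] L) :
    ((ContinuousLinearMap.adjoint J ∘L J : X →L[ℂ] X) : X →ₗ[ℂ] X).IsSymmetric := by
  intro x y
  simp [ContinuousLinearMap.adjoint_inner_left, ContinuousLinearMap.adjoint_inner_right]

/-- The Poincaré max-min principle: if `c ‖u‖² ≤ ‖J u‖²` on a subspace of dimension `j`, then
`J† J` has `j` orthogonal eigenvectors with eigenvalues at least `c`. -/
theorem exists_eigenvectors_of_le_on_subspace {J : X →L[ℂ] L} (hJ : IsCompactOperator J) {c : ℝ}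
    (hc : 0 < c) (W : Submodule ℂ X) [FiniteDimensional ℂ W]
    (hW : ∀ u ∈ W, c * ‖u‖ ^ 2 ≤ ‖J u‖ ^ 2) {n : ℕ} (hn : n ≤ Module.finrank ℂ W) :
    ∃ v : Fin n → X, (∀ i, v i ≠ 0) ∧ Pairwise (fun i k => inner ℂ (v i) (v k) = 0) ∧
      ∀ i, ∃ l : ℝ, c ≤ l ∧ ContinuousLinearMap.adjoint J (J (v i)) = (l : ℂ) • v i := by
  induction n with
  | zero => exact ⟨Fin.elim0, fun i => i.elim0, fun i => i.elim0, fun i => i.elim0⟩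
  | succ n ih =>
    obtain ⟨v, hv0, hv1, hv2⟩ := ih (by omega)
    set M : Submodule ℂ X := Submodule.span ℂ (Set.range v) with hM
    have : FiniteDimensional ℂ M := FiniteDimensional.span_of_finite ℂ (Set.finite_range v)
    have hMn : Module.finrank ℂ M ≤ n := by
      simpa [Set.finrank] using finrank_range_le_card (R := ℂ) v
    -- `W` has dimension at least n + 1 and `M` at most n, so projecting `W` to `M` has a kernel.
    -- This vector is the test vector for the restriction of `T` to `Mᗮ`.
    obtain ⟨x, hxW, hxM, hx0⟩ : ∃ x ∈ W, x ∈ Mᗮ ∧ x ≠ 0 := by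
      let P : W →ₗ[ℂ] M := (M.orthogonalProjectionOnto : X →ₗ[ℂ] M) ∘ₗ W.subtype
      have hker : LinearMap.ker P ≠ ⊥ := by
        apply LinearMap.ker_ne_bot_of_finrank_lt
        omega
      obtain ⟨y, hy, hy0⟩ := (Submodule.ne_bot_iff _).1 hker
      refine ⟨y, y.2, ?_, by simpa using hy0⟩
      rw [← Submodule.orthogonalProjectionOnto_eq_zero_iff]
      simpa [P] using hy
    set T : X →L[ℂ] X := ContinuousLinearMap.adjoint J ∘L J with hT
    have hTs := adjoint_comp_self_isSymmetric J
    have hTc : IsCompactOperator T := hJ.clm_comp (ContinuousLinearMap.adjoint J)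
    have hinv : ∀ y ∈ Mᗮ, (T : X →ₗ[ℂ] X) y ∈ Mᗮ := by
      intro y hy
      rw [Submodule.mem_orthogonal] at hy ⊢
      intro u hu
      rw [← hTs u y]
      refine hy _ ?_
      induction hu using Submodule.span_induction with
      | mem u hu =>
        obtain ⟨i, rfl⟩ := hu
        obtain ⟨l, -, hl⟩ := hv2 i
        have : (T : X →ₗ[ℂ] X) (v i) = (l : ℂ) • v i := hl
        exact this ▸ M.smul_mem _ (Submodule.subset_span ⟨i, rfl⟩)
      | zero => simp
      | add u w _ _ h1 h2 => rw [map_add]; exact M.add_mem h1 h2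
      | smul a u _ h1 => rw [map_smul]; exact M.smul_mem _ h1
    let S : Mᗮ →L[ℂ] Mᗮ := T.restrict hinv
    have hSc : IsCompactOperator S := hTc.restrict' hinv
    have hSs : S.IsSymmetric := hTs.restrict_invariant hinv
    have hform : ∀ y : Mᗮ, S.reApplyInnerSelf y = ‖J y‖ ^ 2 := by
      intro y
      rw [ContinuousLinearMap.reApplyInnerSelf_apply]
      change RCLike.re (inner ℂ (ContinuousLinearMap.adjoint J (J y)) (y : X)) = _
      rw [ContinuousLinearMap.adjoint_inner_left]
      exact inner_self_eq_norm_sq _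
    obtain ⟨l, hl, w, hw0, hw⟩ := exists_hasEigenvalue_of_compact_of_nonneg hSc hSs
      (fun y => by rw [hform]; positivity) hc (x := ⟨x, hxM⟩) (by simpa using hx0)
      (by rw [hform]; exact hW x hxW)
    have hw' : ContinuousLinearMap.adjoint J (J (w : X)) = (l : ℂ) • (w : X) :=
      congrArg Subtype.val hw
    have horth : ∀ i, inner ℂ (v i) (w : X) = 0 := fun i =>
      (Submodule.mem_orthogonal _ _).1 w.2 _ (Submodule.subset_span ⟨i, rfl⟩)
    refine ⟨Fin.snoc v (w : X), ?_, ?_, ?_⟩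
    · intro i
      refine Fin.lastCases ?_ (fun i => ?_) i
      · simpa using hw0
      · simpa using hv0 i
    · intro i k
      refine Fin.lastCases ?_ (fun i => ?_) i <;> refine Fin.lastCases ?_ (fun k => ?_) k
      · intro h; exact absurd rfl h
      · intro _
        simpa using inner_eq_zero_symm.1 (horth k)
      · intro _
        simpa using horth i
      · intro h
        simpa using hv1 (fun hik => h (by rw [hik]))
    · intro i
      refine Fin.lastCases ?_ (fun i => ?_) i
      · simpa using ⟨l, hl, hw'⟩
      · simpa using hv2 i

/-- On the span of eigenvectors of `J† J` with eigenvalues at least `c`, `c ‖u‖² ≤ ‖J u‖²`. -/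
theorem le_on_span_of_eigenvectors (J : X →L[ℂ] L) {c : ℝ} {ι : Type*} {v : ι → X}
    (hv : ∀ i, ∃ l : ℝ, c ≤ l ∧ ContinuousLinearMap.adjoint J (J (v i)) = (l : ℂ) • v i)
    {u : X} (hu : u ∈ Submodule.span ℂ (Set.range v)) : c * ‖u‖ ^ 2 ≤ ‖J u‖ ^ 2 := by
  classical
  set T : X →ₗ[ℂ] X := ((ContinuousLinearMap.adjoint J ∘L J : X →L[ℂ] X) : X →ₗ[ℂ] X) with hT
  have hTs : T.IsSymmetric := adjoint_comp_self_isSymmetric J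
  -- The `v i` need not be orthogonal, so `u` is decomposed along whole eigenspaces, which are
  -- orthogonal for distinct eigenvalues.
  let I := {l : ℂ // ∃ s : ℝ, c ≤ s ∧ l = (s : ℂ)}
  have hmem : u ∈ ⨆ l : I, Module.End.eigenspace T l.1 := by
    refine Submodule.span_le.2 ?_ hu
    rintro _ ⟨i, rfl⟩
    obtain ⟨l, hl, h⟩ := hv i
    exact Submodule.mem_iSup_of_mem (⟨(l : ℂ), l, hl, rfl⟩ : I)
      (Module.End.mem_eigenspace_iff.2 h)
  obtain ⟨f, hf, rfl⟩ := (Submodule.mem_iSup_iff_exists_finsupp _ _).1 hmem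
  have hfam : OrthogonalFamily ℂ (fun l : I => Module.End.eigenspace T l.1)
      (fun l => (Module.End.eigenspace T l.1).subtypeₗᵢ) :=
    hTs.orthogonalFamily_eigenspaces.comp Subtype.val_injective
  have hn : ‖f.sum fun _ x => x‖ ^ 2 = ∑ i ∈ f.support, ‖f i‖ ^ 2 :=
    hfam.norm_sum (fun i => ⟨f i, hf i⟩) f.support
  have hJn : ‖J (f.sum fun _ x => x)‖ ^ 2
      = RCLike.re (inner ℂ (f.sum fun _ x => x) (T (f.sum fun _ x => x))) := by
    change _ = RCLike.re (inner ℂ _ (ContinuousLinearMap.adjoint J (J _)))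
    rw [ContinuousLinearMap.adjoint_inner_right]
    exact (inner_self_eq_norm_sq _).symm
  have hTf : ∀ i, T (f i) = i.1 • f i := fun i => Module.End.mem_eigenspace_iff.1 (hf i)
  have hi : inner ℂ (f.sum fun _ x => x) (T (f.sum fun _ x => x))
      = ∑ i ∈ f.support, inner ℂ (f i) (i.1 • f i) := by
    have h1 : T (f.sum fun _ x => x) = ∑ i ∈ f.support, i.1 • f i := by
      rw [Finsupp.sum, map_sum]
      exact Finset.sum_congr rfl fun i _ => hTf i
    rw [h1]
    exact hfam.inner_sum (fun i => ⟨f i, hf i⟩)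
      (fun i => ⟨i.1 • f i, Submodule.smul_mem _ _ (hf i)⟩) f.support
  rw [hJn, hi, hn, map_sum, Finset.mul_sum]
  refine Finset.sum_le_sum fun i _ => ?_
  obtain ⟨s, hs, h⟩ := i.2
  rw [h, inner_smul_right, inner_self_eq_norm_sq_to_K]
  have : RCLike.re ((s : ℂ) * (RCLike.ofReal ‖f i‖ : ℂ) ^ 2) = s * ‖f i‖ ^ 2 := by
    rw [← RCLike.ofReal_pow]
    exact Complex.re_ofReal_mul s _
  rw [this]
  gcongr

/-- Pair the hypothesis with `u`. For nonzero `u` this forces `c` to be positive, which is how μ + 1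
> 0 is obtained for eigenvalues μ. -/
theorem norm_sq_eq_of_eq_smul_comp_adjoint (J : X →L[ℂ] L) {u : L} {c : ℝ}
    (h : u = (c : ℂ) • J (ContinuousLinearMap.adjoint J u)) :
    ‖u‖ ^ 2 = c * ‖ContinuousLinearMap.adjoint J u‖ ^ 2 := by
  have h1 : inner ℂ u u
      = (c : ℂ) * inner ℂ (ContinuousLinearMap.adjoint J u) (ContinuousLinearMap.adjoint J u) := by
    rw [ContinuousLinearMap.adjoint_inner_left, ← inner_smul_right, ← h]
  rw [inner_self_eq_norm_sq_to_K, inner_self_eq_norm_sq_to_K] at h1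
  exact Complex.ofReal_injective (by push_cast; exact h1)

end AbstractMinMax

/-! ### Weak derivatives and uniqueness of square integrable weak solutions. -/

section WeakSolutions

/-- A compactly supported function on the line vanishes outside a bounded interval. -/
theorem HasCompactSupport.exists_forall_le_abs_eq_zero {E : Type*} [Zero E] {f : ℝ → E}
    (hf : HasCompactSupport f) : ∃ R : ℝ, 0 < R ∧ ∀ x, R ≤ |x| → f x = 0 := by
  obtain ⟨R, hR⟩ := hf.isCompact.isBounded.subset_closedBall 0
  refine ⟨max R 0 + 1, by positivity, fun x hx => ?_⟩
  by_contra h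
  have h1 := hR (subset_tsupport f h)
  rw [mem_closedBall_zero_iff, Real.norm_eq_abs] at h1
  have := le_max_left R 0
  linarith

theorem ContDiff.deriv_infty {f : ℝ → ℝ} (hf : ContDiff ℝ ∞ f) : ContDiff ℝ ∞ (deriv f) :=
  (contDiff_infty_iff_deriv.1 hf).2

/-- A test function with vanishing integral is the derivative of a test function. -/
theorem exists_test_primitive {χ : ℝ → ℝ} (hχ : ContDiff ℝ ∞ χ) (hs : HasCompactSupport χ)
    (h0 : ∫ x, χ x = 0) : ∃ φ : ℝ → ℝ, ContDiff ℝ ∞ φ ∧ HasCompactSupport φ ∧ deriv φ = χ := by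
  obtain ⟨R, hR, hz⟩ := hs.exists_forall_le_abs_eq_zero
  have hd : ∀ x, HasDerivAt (fun y => ∫ t in (-R)..y, χ t) (χ x) x := fun x =>
    (hχ.continuous.integral_hasStrictDerivAt (-R) x).hasDerivAt
  have hder : deriv (fun y => ∫ t in (-R)..y, χ t) = χ := funext fun x => (hd x).deriv
  refine ⟨fun y => ∫ t in (-R)..y, χ t, ?_, ?_, hder⟩
  · rw [contDiff_infty_iff_deriv, hder]
    exact ⟨fun x => (hd x).differentiableAt, hχ⟩
  · refine HasCompactSupport.intro (isCompact_Icc (a := -R) (b := R)) fun y hy => ?_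
    rw [Set.mem_Icc, not_and_or, not_le, not_le] at hy
    rcases hy with hy | hy
    · refine (intervalIntegral.integral_congr (g := fun _ => 0) fun t ht => ?_).trans (by simp)
      rw [Set.uIcc_of_ge hy.le] at ht
      exact hz t (by rw [le_abs]; right; linarith [ht.2])
    · have hsub : Function.support χ ⊆ Set.Ioc (-R) y := by
        intro t ht
        by_contra hcon
        refine ht (hz t ?_)
        rw [Set.mem_Ioc, not_and_or, not_lt, not_le] at hcon
        rcases hcon with h | h
        · rw [le_abs]; right; linarith
        · rw [le_abs]; left; linarith
      change ∫ t in (-R)..y, χ t = 0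
      rw [intervalIntegral.integral_eq_integral_of_support_subset hsub, h0]

/-- The product of a test function and a locally integrable function is integrable. -/
theorem integrable_test_mul {g v : ℝ → ℝ} (hg : Continuous g) (hs : HasCompactSupport g)
    (hv : LocallyIntegrable v volume) : Integrable (fun x => g x * v x) volume :=
  hv.integrable_smul_left_of_hasCompactSupport hg hs

/-- A test function with integral one. -/
theorem exists_test_integral_eq_one :
    ∃ ψ : ℝ → ℝ, ContDiff ℝ ∞ ψ ∧ HasCompactSupport ψ ∧ ∫ x, ψ x = 1 := by
  let f : ContDiffBump (0 : ℝ) := default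
  exact ⟨f.normed volume, f.contDiff_normed, f.hasCompactSupport_normed, f.integral_normed⟩

/-- The lemma of du Bois-Reymond: a function with vanishing weak derivative is constant. -/
theorem ae_eq_const_of_integral_deriv_mul_eq_zero {v : ℝ → ℝ} (hv : LocallyIntegrable v volume)
    (h : ∀ φ : ℝ → ℝ, ContDiff ℝ ∞ φ → HasCompactSupport φ → ∫ x, deriv φ x * v x = 0) :
    ∃ c : ℝ, ∀ᵐ x, v x = c := by
  obtain ⟨ψ, hψ, hψs, hψ1⟩ := exists_test_integral_eq_one
  -- Testing against `ψ` fixes the constant. Any test function minus its integral times `ψ` has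
  -- integral zero, hence is the derivative of a test function.
  refine ⟨∫ x, ψ x * v x, ?_⟩
  refine ae_eq_of_integral_contDiff_smul_eq hv (locallyIntegrable_const _) fun g hg hgs => ?_
  obtain ⟨φ, hφ, hφs, hφd⟩ := exists_test_primitive
    (χ := fun x => g x - (∫ y, g y) * ψ x) (hg.sub (contDiff_const.mul hψ))
    (hgs.sub (hψs.mul_left (f := fun _ => ∫ y, g y))) (by
      rw [integral_sub (hg.continuous.integrable_of_hasCompactSupport hgs)
        ((hψ.continuous.integrable_of_hasCompactSupport hψs).const_mul _), integral_const_mul,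
        hψ1, mul_one, sub_self])
  have h1 := h φ hφ hφs
  rw [hφd] at h1
  have h2 : ∫ x, (g x - (∫ y, g y) * ψ x) * v x
      = (∫ x, g x * v x) - (∫ y, g y) * ∫ x, ψ x * v x := by
    rw [← integral_const_mul, ← integral_sub (integrable_test_mul hg.continuous hgs hv)
      ((integrable_test_mul hψ.continuous hψs hv).const_mul _)]
    congr 1; ext x; ring
  rw [h2] at h1
  simp only [smul_eq_mul]
  rw [integral_mul_const]
  linarith

/-- Integration by parts of a test function against a primitive of a locally integrable function. -/
theorem integral_deriv_mul_primitive {F : ℝ → ℝ} (hF : LocallyIntegrable F volume) {φ : ℝ → ℝ}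
    (hφ : ContDiff ℝ ∞ φ) (hs : HasCompactSupport φ) :
    ∫ x, deriv φ x * (∫ t in (0 : ℝ)..x, F t) = -∫ x, φ x * F x := by
  obtain ⟨R, hR, hz⟩ := hs.exists_forall_le_abs_eq_zero
  have hsub : Function.support φ ⊆ Set.Ioo (-R) R := by
    intro t ht
    by_contra hcon
    refine ht (hz t ?_)
    by_contra hlt
    exact hcon (abs_lt.1 (not_le.1 hlt))
  -- The support of the derivative is only known to lie in the closed interval [-R, R], which fits
  -- in a half-open one after enlarging `R`.
  have htsub : Function.support (deriv φ) ⊆ Set.Ioc (-(R + 1)) (R + 1) := by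
    refine (support_deriv_subset (f := φ)).trans ?_
    refine (closure_mono hsub).trans ?_
    refine (closure_mono Set.Ioo_subset_Icc_self).trans ?_
    rw [isClosed_Icc.closure_eq]
    intro x hx
    exact ⟨by linarith [hx.1], by linarith [hx.2]⟩
  have hsub' : Function.support φ ⊆ Set.Ioc (-(R + 1)) (R + 1) := fun x hx =>
    ⟨by linarith [(hsub hx).1], by linarith [(hsub hx).2]⟩
  have hint : IntervalIntegrable F volume (-(R + 1)) (R + 1) :=
    (hF.integrableOn_isCompact isCompact_uIcc).intervalIntegrable
  -- `F` is merely locally integrable, so its primitive is absolutely continuous and differentiable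
  -- only almost everywhere.
  have hP := hint.absolutelyContinuousOnInterval_intervalIntegral (c := 0)
    (by rw [Set.uIcc_of_le (by linarith)]; constructor <;> linarith)
  have hφa : AbsolutelyContinuousOnInterval φ (-(R + 1)) (R + 1) :=
    (hφ.of_le (by exact_mod_cast le_top)).contDiffOn.absolutelyContinuousOnInterval
  have key := hP.integral_mul_deriv_eq_deriv_mul hφa
  rw [hz (R + 1) (by rw [le_abs]; left; linarith), hz (-(R + 1)) (by rw [le_abs]; right; linarith),
    mul_zero, mul_zero, sub_zero, zero_sub] at key
  have e1 : ∫ x, deriv φ x * (∫ t in (0 : ℝ)..x, F t)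
      = ∫ x in (-(R + 1))..(R + 1), (∫ t in (0 : ℝ)..x, F t) * deriv φ x := by
    rw [intervalIntegral.integral_eq_integral_of_support_subset]
    · exact integral_congr_ae (Filter.Eventually.of_forall fun x => mul_comm _ _)
    · exact (Function.support_mul_subset_right _ _).trans htsub
  have e2 : ∫ x, φ x * F x
      = ∫ x in (-(R + 1))..(R + 1), deriv (fun x => ∫ t in (0 : ℝ)..x, F t) x * φ x := by
    rw [intervalIntegral.integral_eq_integral_of_support_subset]
    · refine integral_congr_ae ?_
      filter_upwards [LocallyIntegrable.ae_hasDerivAt_integral hF] with x hx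
      rw [(hx 0).deriv, mul_comm]
    · exact (Function.support_mul_subset_right _ _).trans hsub'
  rw [e1, e2, key]

theorem continuous_primitive_of_locallyIntegrable {F : ℝ → ℝ} (hF : LocallyIntegrable F volume) :
    Continuous fun x => ∫ t in (0 : ℝ)..x, F t :=
  intervalIntegral.continuous_primitive
    (fun _ _ => (hF.integrableOn_isCompact isCompact_uIcc).intervalIntegrable) 0

/-- A function with vanishing second weak derivative is affine. -/
theorem ae_eq_affine_of_integral_deriv2_mul_eq_zero {v : ℝ → ℝ} (hv : LocallyIntegrable v volume)
    (h : ∀ φ : ℝ → ℝ, ContDiff ℝ ∞ φ → HasCompactSupport φ → ∫ x, deriv (deriv φ) x * v x = 0) :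
    ∃ c m : ℝ, ∀ᵐ x, v x = c + m * x := by
  obtain ⟨ψ, hψ, hψs, hψ1⟩ := exists_test_integral_eq_one
  -- For v = c + m x, integration by parts gives ∫ ψ' v = -m, so this is the only possible slope.
  set m : ℝ := -∫ x, deriv ψ x * v x with hm
  have hlin : Continuous fun x : ℝ => m * x := by fun_prop
  obtain ⟨c, hc⟩ := ae_eq_const_of_integral_deriv_mul_eq_zero
    (v := fun x => v x - m * x) (hv.sub hlin.locallyIntegrable) (fun g hg hgs => by
      have hint := hg.continuous.integrable_of_hasCompactSupport hgs (μ := volume)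
      obtain ⟨φ, hφ, hφs, hφd⟩ := exists_test_primitive
        (χ := fun x => g x - (∫ y, g y) * ψ x) (hg.sub (contDiff_const.mul hψ))
        (hgs.sub (hψs.mul_left (f := fun _ => ∫ y, g y))) (by
          rw [integral_sub hint ((hψ.continuous.integrable_of_hasCompactSupport hψs).const_mul _),
            integral_const_mul, hψ1, mul_one, sub_self])
      have h1 := h φ hφ hφs
      have hd : deriv (deriv φ) = fun x => deriv g x - (∫ y, g y) * deriv ψ x := by
        rw [hφd]; ext x
        rw [deriv_fun_sub (hg.differentiable (by simp)).differentiableAt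
          ((hψ.differentiable (by simp)).differentiableAt.const_mul _),
          deriv_const_mul _ (hψ.differentiable (by simp)).differentiableAt]
      have i1 := integrable_test_mul hg.deriv_infty.continuous hgs.deriv hv
      have i2 := integrable_test_mul hψ.deriv_infty.continuous hψs.deriv hv
      have i3 := integrable_test_mul hg.deriv_infty.continuous hgs.deriv hlin.locallyIntegrable
      have h2 : ∫ x, deriv (deriv φ) x * v x
          = (∫ x, deriv g x * v x) + (∫ y, g y) * m := by
        rw [hd, hm, mul_neg, ← sub_eq_add_neg, ← integral_const_mul,
          ← integral_sub i1 (i2.const_mul _)]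
        congr 1; ext x; ring
      have h3 : ∫ x, deriv g x * (m * x) = -((∫ y, g y) * m) := by
        have h4 := integral_deriv_mul_primitive (F := fun _ => m) (locallyIntegrable_const m) hg hgs
        rw [integral_mul_const] at h4
        rw [← h4]
        congr 1; ext x
        simp [mul_comm]
      have h5 : ∫ x, deriv g x * (v x - m * x)
          = (∫ x, deriv g x * v x) - ∫ x, deriv g x * (m * x) := by
        rw [← integral_sub i1 i3]
        congr 1; ext x; ring
      rw [h5, h3, sub_neg_eq_add, ← h2, h1])
  refine ⟨c, m, ?_⟩
  filter_upwards [hc] with x hx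
  linarith

/-- A convex, nonnegative and integrable function on the line vanishes. -/
theorem ConvexOn.eq_zero_of_integrable {s : ℝ → ℝ} (hs : ConvexOn ℝ Set.univ s)
    (h0 : ∀ x, 0 ≤ s x) (hi : Integrable s volume) (x : ℝ) : s x = 0 := by
  -- Midpoint convexity gives 2 s(x) ≤ s(x + t) + s(x - t); thus the constant 2 s(x) is integrable
  -- in t over the line and must vanish.
  have h1 : Integrable (fun t => s (x + t) + s (x - t)) volume :=
    (hi.comp_add_left x).add (hi.comp_sub_left x)
  have h2 : Integrable (fun _ : ℝ => 2 * s x) volume := by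
    refine h1.mono aestronglyMeasurable_const (Filter.Eventually.of_forall fun t => ?_)
    have h3 := (id hs.2) (Set.mem_univ (x + t)) (Set.mem_univ (x - t))
      (by norm_num : (0 : ℝ) ≤ 1 / 2) (by norm_num : (0 : ℝ) ≤ 1 / 2) (by norm_num)
    simp only [smul_eq_mul] at h3
    rw [show 1 / 2 * (x + t) + 1 / 2 * (x - t) = x by ring] at h3
    rw [Real.norm_of_nonneg (by linarith [h0 x]),
      Real.norm_of_nonneg (add_nonneg (h0 _) (h0 _))]
    linarith
  rw [integrable_const_iff] at h2
  rcases h2 with h2 | h2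
  · linarith
  · have := h2.measure_univ_lt_top
    simp at this

/-- A square integrable weak solution of `-w'' + V w = 0` with `V ≥ 0` vanishes. -/
theorem ae_eq_zero_of_weak_solution (V : C(ℝ, ℝ)) (hV : ∀ x, 0 ≤ V x) {w : ℝ → ℝ}
    (hw : LocallyIntegrable w volume) (hw2 : Integrable (fun x => w x ^ 2) volume)
    (h : ∀ φ : ℝ → ℝ, ContDiff ℝ ∞ φ → HasCompactSupport φ →
      ∫ x, (-(deriv (deriv φ) x) + V x * φ x) * w x = 0) : ∀ᵐ x, w x = 0 := by
  set F : ℝ → ℝ := fun x => V x * w x with hFdef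
  have hF : LocallyIntegrable F volume := hw.continuous_mul V.continuous
  set P : ℝ → ℝ := fun x => ∫ t in (0 : ℝ)..x, F t with hPdef
  have hPc : Continuous P := continuous_primitive_of_locallyIntegrable hF
  set G : ℝ → ℝ := fun x => ∫ t in (0 : ℝ)..x, P t with hGdef
  have hGc : Continuous G := continuous_primitive_of_locallyIntegrable hPc.locallyIntegrable
  -- Regularity: `G` is a second primitive of V w, so w - G has zero second weak derivative. Hence w
  -- agrees almost everywhere with a C¹ function `y` whose derivative is again differentiable.
  obtain ⟨c, m, hcm⟩ := ae_eq_affine_of_integral_deriv2_mul_eq_zero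
    (v := fun x => w x - G x) (hw.sub hGc.locallyIntegrable) (fun φ hφ hs => by
      have i1 := integrable_test_mul hφ.deriv_infty.deriv_infty.continuous hs.deriv.deriv hw
      have i2 := integrable_test_mul hφ.deriv_infty.deriv_infty.continuous hs.deriv.deriv
        hGc.locallyIntegrable
      have i3 := integrable_test_mul hφ.continuous hs hF
      have e1 : ∫ x, (-(deriv (deriv φ) x) + V x * φ x) * w x
          = (∫ x, φ x * F x) - ∫ x, deriv (deriv φ) x * w x := by
        rw [← integral_sub i3 i1]
        congr 1; ext x; simp only [hFdef]; ring
      have e2 := integral_deriv_mul_primitive hPc.locallyIntegrable hφ.deriv_infty hs.deriv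
      have e3 := integral_deriv_mul_primitive hF hφ hs
      have e4 := h φ hφ hs
      have e5 : ∫ x, deriv (deriv φ) x * (w x - G x)
          = (∫ x, deriv (deriv φ) x * w x) - ∫ x, deriv (deriv φ) x * G x := by
        rw [← integral_sub i1 i2]
        congr 1; ext x; ring
      rw [e5]
      simp only [hGdef, hPdef] at *
      linarith)
  set y : ℝ → ℝ := fun x => c + m * x + G x with hy
  have hwy : ∀ᵐ x, w x = y x := by
    filter_upwards [hcm] with x hx
    simp only [hy]; linarith
  have hyc : Continuous y := by fun_prop
  have hPy : ∀ x, P x = ∫ t in (0 : ℝ)..x, V t * y t := fun x =>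
    intervalIntegral.integral_congr_ae (by
      filter_upwards [hwy] with t ht _
      simp only [hFdef]; rw [ht])
  have hPd : ∀ x, HasDerivAt P (V x * y x) x := by
    intro x
    rw [show P = fun x => ∫ t in (0 : ℝ)..x, V t * y t from funext hPy]
    have hc : Continuous fun t => V t * y t := V.continuous.mul hyc
    exact (hc.integral_hasStrictDerivAt 0 x).hasDerivAt
  have hyd : ∀ x, HasDerivAt y (m + P x) x := by
    intro x
    have hG : HasDerivAt G (P x) x :=
      (hPc.integral_hasStrictDerivAt 0 x).hasDerivAt
    have := (((hasDerivAt_id x).const_mul m).const_add c).add hG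
    simp only [mul_one] at this
    exact this
  have hsd : ∀ x, HasDerivAt (fun x => y x ^ 2) (2 * (y x * (m + P x))) x := fun x => by
    convert! (hyd x).pow 2 using 1; push_cast; ring
  have hsd' : deriv (fun x => y x ^ 2) = fun x => 2 * (y x * (m + P x)) :=
    funext fun x => (hsd x).deriv
  have hsd2 : ∀ x, HasDerivAt (fun x => 2 * (y x * (m + P x)))
      (2 * ((m + P x) * (m + P x) + y x * (V x * y x))) x := fun x =>
    (((hyd x).mul ((hPd x).const_add m)).const_mul 2)
  -- (y²)'' = 2 (y')² + 2 V y² ≥ 0, and y² is integrable, so it vanishes.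
  have hconv : ConvexOn ℝ Set.univ fun x => y x ^ 2 := by
    refine convexOn_of_deriv2_nonneg' convex_univ
      (fun x _ => (hsd x).differentiableAt.differentiableWithinAt) ?_ ?_
    · rw [hsd']
      exact fun x _ => (hsd2 x).differentiableAt.differentiableWithinAt
    · intro x _
      rw [Function.iterate_succ, Function.iterate_one, Function.comp_apply, hsd', (hsd2 x).deriv]
      have := hV x
      have : 0 ≤ V x * y x ^ 2 := by positivity
      nlinarith [mul_self_nonneg (m + P x)]
  have hyi : Integrable (fun x => y x ^ 2) volume := hw2.congr (by
    filter_upwards [hwy] with x hx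
    rw [hx])
  filter_upwards [hwy] with x hx
  rw [hx]
  exact pow_eq_zero_iff two_ne_zero |>.1
    (hconv.eq_zero_of_integrable (fun x => sq_nonneg _) hyi x)

end WeakSolutions

/-! ### The form domain, the resolvent `J J†`, and trial spaces versus eigenvectors. -/

section FormDomain

/-- Triples of square integrable functions, with the Hilbert space norm. -/
abbrev FormSpace : Type := PiLp 2 (fun _ : Fin 3 => L2R)

/-- The triples `(f, f', a f)` in `L²(ℝ)³` with `f` continuously differentiable. -/
noncomputable def formCore (a : C(ℝ, ℝ)) : Submodule ℂ FormSpace where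
  carrier := {p | ∃ f : ℝ → ℂ, ContDiff ℝ 1 f ∧ p 0 =ᵐ[volume] f ∧ p 1 =ᵐ[volume] deriv f ∧
    p 2 =ᵐ[volume] fun x => (a x : ℂ) * f x}
  zero_mem' := by
    refine ⟨0, contDiff_const, Lp.coeFn_zero _ _ _, ?_, ?_⟩
    · filter_upwards [Lp.coeFn_zero ℂ 2 (volume : Measure ℝ)] with x hx
      rw [PiLp.zero_apply, hx]; simp
    · filter_upwards [Lp.coeFn_zero ℂ 2 (volume : Measure ℝ)] with x hx
      rw [PiLp.zero_apply, hx]; simp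
  add_mem' := by
    rintro p q ⟨f, hf, f0, f1, f2⟩ ⟨g, hg, g0, g1, g2⟩
    refine ⟨f + g, hf.add hg, ?_, ?_, ?_⟩
    · filter_upwards [Lp.coeFn_add (p 0) (q 0), f0, g0] with x h1 h2 h3
      rw [PiLp.add_apply, h1, Pi.add_apply, h2, h3, Pi.add_apply]
    · filter_upwards [Lp.coeFn_add (p 1) (q 1), f1, g1] with x h1 h2 h3
      rw [PiLp.add_apply, h1, Pi.add_apply, h2, h3, deriv_add
        (hf.differentiable one_ne_zero).differentiableAt
        (hg.differentiable one_ne_zero).differentiableAt]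
    · filter_upwards [Lp.coeFn_add (p 2) (q 2), f2, g2] with x h1 h2 h3
      rw [PiLp.add_apply, h1, Pi.add_apply, h2, h3, Pi.add_apply, mul_add]
  smul_mem' := by
    rintro c p ⟨f, hf, f0, f1, f2⟩
    refine ⟨c • f, contDiff_const.smul hf, ?_, ?_, ?_⟩
    · filter_upwards [Lp.coeFn_smul c (p 0), f0] with x h1 h2
      rw [PiLp.smul_apply, h1, Pi.smul_apply, h2, Pi.smul_apply]
    · filter_upwards [Lp.coeFn_smul c (p 1), f1] with x h1 h2
      rw [PiLp.smul_apply, h1, Pi.smul_apply, h2, deriv_const_smul _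
        (hf.differentiable one_ne_zero).differentiableAt]
    · filter_upwards [Lp.coeFn_smul c (p 2), f2] with x h1 h2
      rw [PiLp.smul_apply, h1, Pi.smul_apply, h2, Pi.smul_apply, smul_eq_mul, smul_eq_mul,
        mul_left_comm]

/-- The form domain of `-d²/dx² + a²`, embedded in `L²(ℝ)³` by `u ↦ (u, u', a u)`. -/
noncomputable def formDomain (a : C(ℝ, ℝ)) : Submodule ℂ FormSpace := (formCore a).topologicalClosure

instance (a : C(ℝ, ℝ)) : CompleteSpace (formDomain a) :=
  inferInstanceAs (CompleteSpace (formCore a).topologicalClosure)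

/-- The embedding of the form domain in `L²(ℝ)`. -/
noncomputable def formEmbedding (a : C(ℝ, ℝ)) : formDomain a →L[ℂ] L2R :=
  (PiLp.proj 2 (fun _ : Fin 3 => L2R) 0 : FormSpace →L[ℂ] L2R) ∘L (formDomain a).subtypeL

theorem memLp_ofReal_of_hasCompactSupport {g : ℝ → ℝ} (hg : Continuous g)
    (hs : HasCompactSupport g) : MemLp (fun x => (g x : ℂ)) 2 volume :=
  (Complex.continuous_ofReal.comp hg).memLp_of_hasCompactSupport
    (hs.comp_left (g := fun x : ℝ => (x : ℂ)) Complex.ofReal_zero)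

/-- The element of `L²(ℝ)` given by a continuous real function of compact support. -/
noncomputable def testLp (g : ℝ → ℝ) (hg : Continuous g) (hs : HasCompactSupport g) : L2R :=
  (memLp_ofReal_of_hasCompactSupport hg hs).toLp _

theorem inner_testLp {g : ℝ → ℝ} (hg : Continuous g) (hs : HasCompactSupport g) (u : L2R) :
    inner ℂ (testLp g hg hs) u = ∫ x, g x • u x := by
  rw [L2.inner_def]
  refine integral_congr_ae ?_
  filter_upwards [(memLp_ofReal_of_hasCompactSupport hg hs).coeFn_toLp] with x hx
  rw [testLp, hx, RCLike.inner_apply, Complex.conj_ofReal, Complex.real_smul, mul_comm]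

theorem testLp_mem_formCore (a : C(ℝ, ℝ)) {φ : ℝ → ℝ} (hφ : ContDiff ℝ ∞ φ)
    (hs : HasCompactSupport φ) :
    WithLp.toLp 2 ![testLp φ hφ.continuous hs, testLp (deriv φ) hφ.deriv_infty.continuous hs.deriv,
      testLp (fun x => a x * φ x) (a.continuous.mul hφ.continuous)
        (hs.mul_left (f := fun x => a x))] ∈ formCore a := by
  refine ⟨fun x => (φ x : ℂ), Complex.ofRealCLM.contDiff.comp (hφ.of_le (by exact_mod_cast le_top)),
    MemLp.coeFn_toLp (memLp_ofReal_of_hasCompactSupport hφ.continuous hs), ?_, ?_⟩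
  · refine (MemLp.coeFn_toLp (memLp_ofReal_of_hasCompactSupport hφ.deriv_infty.continuous
      hs.deriv)).trans (Filter.Eventually.of_forall fun x => ?_)
    exact ((hφ.differentiable (by simp) x).hasDerivAt.ofReal_comp).deriv.symm
  · refine (MemLp.coeFn_toLp (memLp_ofReal_of_hasCompactSupport (a.continuous.mul hφ.continuous)
      (hs.mul_left (f := fun x => a x)))).trans (Filter.Eventually.of_forall fun x => ?_)
    simp

/-- The second component of an element of the form domain is the weak derivative of the first. -/
theorem integral_deriv_smul_of_mem_formDomain {a : C(ℝ, ℝ)} {p : FormSpace} (hp : p ∈ formDomain a)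
    {φ : ℝ → ℝ} (hφ : ContDiff ℝ ∞ φ) (hs : HasCompactSupport φ) :
    ∫ x, deriv φ x • p 0 x = -∫ x, φ x • p 1 x := by
  rw [← inner_testLp hφ.continuous hs, ← inner_testLp hφ.deriv_infty.continuous hs.deriv]
  -- The identity is a closed condition on `p`, so it suffices to check it on the C¹ core.
  have hcl : IsClosed {p : FormSpace | inner ℂ (testLp (deriv φ) hφ.deriv_infty.continuous hs.deriv)
      (p 0) = -inner ℂ (testLp φ hφ.continuous hs) (p 1)} :=
    isClosed_eq (by fun_prop) (by fun_prop)
  refine closure_minimal ?_ hcl hp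
  rintro p ⟨f, hf, f0, f1, -⟩
  change inner ℂ _ _ = -inner ℂ _ _
  rw [inner_testLp, inner_testLp]
  have e0 : ∫ x, deriv φ x • p 0 x = ∫ x, deriv φ x • f x :=
    integral_congr_ae (by filter_upwards [f0] with x hx; rw [hx])
  have e1 : ∫ x, φ x • p 1 x = ∫ x, φ x • deriv f x :=
    integral_congr_ae (by filter_upwards [f1] with x hx; rw [hx])
  have hfc : Continuous (deriv f) := hf.continuous_deriv le_rfl
  have i0 : Integrable (fun x => deriv φ x • f x) volume :=
    hf.continuous.locallyIntegrable.integrable_smul_left_of_hasCompactSupport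
      hφ.deriv_infty.continuous hs.deriv
  have i1 : Integrable (fun x => φ x • deriv f x) volume :=
    hfc.locallyIntegrable.integrable_smul_left_of_hasCompactSupport hφ.continuous hs
  have i2 : Integrable (fun x => φ x • f x) volume :=
    hf.continuous.locallyIntegrable.integrable_smul_left_of_hasCompactSupport hφ.continuous hs
  have hd : ∀ x, HasDerivAt (fun x => φ x • f x) (φ x • deriv f x + deriv φ x • f x) x := fun x =>
    (hφ.differentiable (by simp) x).hasDerivAt.smul (hf.differentiable one_ne_zero x).hasDerivAt
  have key := integral_eq_zero_of_hasDerivAt_of_integrable hd (i1.add i0) i2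
  rw [integral_add i1 i0] at key
  rw [e0, e1]
  linear_combination key

/-- The third component of an element of the form domain is `a` times the first. -/
theorem integral_smul_of_mem_formDomain {a : C(ℝ, ℝ)} {p : FormSpace} (hp : p ∈ formDomain a)
    {g : ℝ → ℝ} (hg : Continuous g) (hs : HasCompactSupport g) :
    ∫ x, g x • p 2 x = ∫ x, (a x * g x) • p 0 x := by
  have hg' : Continuous fun x => a x * g x := a.continuous.mul hg
  have hs' : HasCompactSupport fun x => a x * g x := hs.mul_left (f := fun x => a x)
  rw [← inner_testLp hg hs, ← inner_testLp hg' hs']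
  have hcl : IsClosed {p : FormSpace | inner ℂ (testLp g hg hs) (p 2)
      = inner ℂ (testLp _ hg' hs') (p 0)} :=
    isClosed_eq (by fun_prop) (by fun_prop)
  refine closure_minimal ?_ hcl hp
  rintro p ⟨f, -, f0, -, f2⟩
  change inner ℂ _ _ = inner ℂ _ _
  rw [inner_testLp, inner_testLp]
  refine integral_congr_ae ?_
  filter_upwards [f0, f2] with x h0 h2
  rw [h0, h2, Complex.real_smul, Complex.real_smul]
  push_cast; ring

/-- `J J†` is a resolvent: `u = J J† f` solves `-u'' + a² u + u = f`. -/
theorem formEmbedding_adjoint_mem_graph (a : C(ℝ, ℝ)) (f : L2R) :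
    (formEmbedding a (ContinuousLinearMap.adjoint (formEmbedding a) f),
      f - formEmbedding a (ContinuousLinearMap.adjoint (formEmbedding a) f))
      ∈ schrodingerGraph (a ^ 2) := by
  intro φ hφ hs
  set p := ContinuousLinearMap.adjoint (formEmbedding a) f with hp
  have hga : Continuous fun x => a x * φ x := a.continuous.mul hφ.continuous
  have hsa : HasCompactSupport fun x => a x * φ x := hs.mul_left (f := fun x => a x)
  -- Pairing (φ, φ', a φ) with J† f yields the weak form of -u'' + a² u + u = f; one integration by
  -- parts then moves the derivative from u' to φ'.
  let Φ : formDomain a := ⟨_, subset_closure (testLp_mem_formCore a hφ hs)⟩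
  have h1 : inner ℂ Φ p = inner ℂ (formEmbedding a Φ) f :=
    ContinuousLinearMap.adjoint_inner_right _ _ _
  have h2 : (∫ x, φ x • (p : FormSpace) 0 x) + (∫ x, deriv φ x • (p : FormSpace) 1 x)
      + (∫ x, (a x * φ x) • (p : FormSpace) 2 x) = ∫ x, φ x • f x := by
    rw [← inner_testLp hφ.continuous hs, ← inner_testLp hφ.continuous hs,
      ← inner_testLp hφ.deriv_infty.continuous hs.deriv, ← inner_testLp hga hsa]
    rw [Submodule.coe_inner, PiLp.inner_apply, Fin.sum_univ_three] at h1
    exact h1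
  have h3 := integral_deriv_smul_of_mem_formDomain p.2 hφ.deriv_infty hs.deriv
  have h4 := integral_smul_of_mem_formDomain p.2 hga hsa
  have i1 := integrable_smul_L2R hφ.deriv_infty.deriv_infty.continuous hs.deriv.deriv
    ((p : FormSpace) 0)
  have i2 : Integrable (fun x => (a x * (a x * φ x)) • (p : FormSpace) 0 x) volume :=
    integrable_smul_L2R (a.continuous.mul hga) (hsa.mul_left (f := fun x => a x)) _
  have e1 : ∫ x, (-(deriv (deriv φ) x) + (a ^ 2) x * φ x) • (p : FormSpace) 0 x
      = (∫ x, (a x * (a x * φ x)) • (p : FormSpace) 0 x)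
        - ∫ x, deriv (deriv φ) x • (p : FormSpace) 0 x := by
    rw [← integral_sub i2 i1]
    congr 1; ext x
    rw [ContinuousMap.pow_apply, ← sub_smul]
    congr 1; ring
  have e2 : ∫ x, φ x • (f - (p : FormSpace) 0) x
      = (∫ x, φ x • f x) - ∫ x, φ x • (p : FormSpace) 0 x := by
    rw [← inner_testLp hφ.continuous hs, ← inner_testLp hφ.continuous hs,
      ← inner_testLp hφ.continuous hs, inner_sub_right]
  change ∫ x, (-(deriv (deriv φ) x) + (a ^ 2) x * φ x) • (p : FormSpace) 0 x
    = ∫ x, φ x • (f - (p : FormSpace) 0) x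
  rw [e1, e2]
  linear_combination h2 - h3 - h4

/-- For `V ≥ 0`, `-1` is not an eigenvalue of the maximal operator `-d²/dx² + V`. -/
theorem eq_zero_of_mem_schrodingerGraph_neg (V : C(ℝ, ℝ)) (hV : ∀ x, 0 ≤ V x) {w : L2R}
    (hw : (w, -w) ∈ schrodingerGraph V) : w = 0 := by
  have hloc : LocallyIntegrable w volume := (Lp.memLp w).locallyIntegrable (by norm_num)
  -- The equation reads -w'' + (V + 1) w = 0. Its coefficients and test functions are real, so real
  -- and imaginary parts solve it separately.
  have hL : ∀ φ : ℝ → ℝ, ContDiff ℝ ∞ φ → HasCompactSupport φ →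
      Integrable (fun x => (-(deriv (deriv φ) x) + (V + 1) x * φ x) • w x) volume ∧
      ∫ x, (-(deriv (deriv φ) x) + (V + 1) x * φ x) • w x = 0 := by
    intro φ hφ hs
    have i0 := integrable_smul_L2R (continuous_schrodinger_test (V + 1) hφ)
      (hasCompactSupport_schrodinger_test (V + 1) hs) w
    refine ⟨i0, ?_⟩
    have h := hw φ hφ hs
    have i1 := integrable_smul_L2R (continuous_schrodinger_test V hφ)
      (hasCompactSupport_schrodinger_test V hs) w
    have i2 := integrable_smul_L2R hφ.continuous hs w
    have e : ∫ x, φ x • (-w : L2R) x = -∫ x, φ x • w x := by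
      rw [← inner_testLp hφ.continuous hs, ← inner_testLp hφ.continuous hs, inner_neg_right]
    change ∫ x, (-(deriv (deriv φ) x) + V x * φ x) • w x = ∫ x, φ x • (-w : L2R) x at h
    rw [e] at h
    have e' : ∫ x, (-(deriv (deriv φ) x) + (V + 1) x * φ x) • w x
        = (∫ x, (-(deriv (deriv φ) x) + V x * φ x) • w x) + ∫ x, φ x • w x := by
      rw [← integral_add i1 i2]
      congr 1; ext x
      rw [← add_smul, ContinuousMap.add_apply, ContinuousMap.one_apply]
      congr 1; ring
    rw [e', h, neg_add_cancel]
  have hV1 : ∀ x, 0 ≤ (V + 1) x := fun x => by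
    rw [ContinuousMap.add_apply, ContinuousMap.one_apply]; linarith [hV x]
  have hre : ∀ᵐ x, (w x).re = 0 := by
    refine ae_eq_zero_of_weak_solution (V + 1) hV1 (w := fun x => (w x).re) ?_ ?_ ?_
    · exact (Lp.memLp w).re.locallyIntegrable (by norm_num)
    · exact (Lp.memLp w).re.integrable_sq
    · intro φ hφ hs
      obtain ⟨hi, h0⟩ := hL φ hφ hs
      have := integral_re hi
      simp only [RCLike.re_to_complex, Complex.smul_re, smul_eq_mul] at this
      rw [this, h0, Complex.zero_re]
  have him : ∀ᵐ x, (w x).im = 0 := by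
    refine ae_eq_zero_of_weak_solution (V + 1) hV1 (w := fun x => (w x).im) ?_ ?_ ?_
    · exact (Lp.memLp w).im.locallyIntegrable (by norm_num)
    · exact (Lp.memLp w).im.integrable_sq
    · intro φ hφ hs
      obtain ⟨hi, h0⟩ := hL φ hφ hs
      have := integral_im hi
      simp only [RCLike.im_to_complex, Complex.smul_im, smul_eq_mul] at this
      rw [this, h0, Complex.zero_im]
  refine Lp.eq_zero_iff_ae_eq_zero.2 ?_
  filter_upwards [hre, him] with x h1 h2
  exact Complex.ext h1 h2

/-- An eigenvector of `-d²/dx² + a²` is an eigenvector of the resolvent `J J†`. -/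
theorem eq_smul_resolvent_of_mem_graph {a : C(ℝ, ℝ)} {u : L2R} {μ : ℝ}
    (hu : (u, (μ : ℂ) • u) ∈ schrodingerGraph (a ^ 2)) :
    u = ((μ + 1 : ℝ) : ℂ) • formEmbedding a (ContinuousLinearMap.adjoint (formEmbedding a) u) := by
  set R := formEmbedding a (ContinuousLinearMap.adjoint (formEmbedding a) u) with hR
  have h1 := formEmbedding_adjoint_mem_graph a u
  rw [← hR] at h1
  -- This combination of graph elements has the form (w, -w) with w = u - (μ + 1) R, so w = 0 by
  -- uniqueness.
  have h2 := Submodule.sub_mem _ hu (Submodule.smul_mem _ ((μ + 1 : ℝ) : ℂ) h1)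
  have h3 : (u, (μ : ℂ) • u) - ((μ + 1 : ℝ) : ℂ) • (R, u - R)
      = (u - ((μ + 1 : ℝ) : ℂ) • R, -(u - ((μ + 1 : ℝ) : ℂ) • R)) := by
    ext1
    · rfl
    · change (μ : ℂ) • u - ((μ + 1 : ℝ) : ℂ) • (u - R) = -(u - ((μ + 1 : ℝ) : ℂ) • R)
      push_cast
      module
  rw [h3] at h2
  exact sub_eq_zero.1 (eq_zero_of_mem_schrodingerGraph_neg _
    (fun x => by rw [ContinuousMap.pow_apply]; positivity) h2)

/-- Applying J to J† J g = l g shows that (H + 1)⁻¹ acts on J g as multiplication by `l`, whence the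
value 1/l - 1 for H. -/
theorem mem_graph_of_eigenvector {a : C(ℝ, ℝ)} {g : formDomain a} {l : ℝ} (hl : l ≠ 0)
    (hg : ContinuousLinearMap.adjoint (formEmbedding a) (formEmbedding a g) = (l : ℂ) • g) :
    (formEmbedding a g, ((1 / l - 1 : ℝ) : ℂ) • formEmbedding a g) ∈ schrodingerGraph (a ^ 2) := by
  have h1 := formEmbedding_adjoint_mem_graph a (formEmbedding a g)
  rw [hg, map_smul] at h1
  have h2 := Submodule.smul_mem _ ((l : ℂ)⁻¹) h1
  have hl' : (l : ℂ) ≠ 0 := by exact_mod_cast hl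
  convert h2 using 1
  ext1
  · change _ = (l : ℂ)⁻¹ • (l : ℂ) • formEmbedding a g
    rw [smul_smul, inv_mul_cancel₀ hl', one_smul]
  · change _ = (l : ℂ)⁻¹ • (formEmbedding a g - (l : ℂ) • formEmbedding a g)
    rw [smul_sub, smul_smul, inv_mul_cancel₀ hl']
    push_cast
    rw [one_div]
    module

/-- The condition on `E` in the definition of `nthEigenvalue`. -/
def HasEigenvectorsBelow (T : L2R →ₗ.[ℂ] L2R) (j : ℕ) (E : ℝ) : Prop :=
  ∃ v : Fin j → L2R, LinearIndependent ℂ v ∧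
    ∀ i, ∃ μ : ℝ, μ ≤ E ∧ ∃ hv : v i ∈ T.domain, T ⟨v i, hv⟩ = (μ : ℂ) • v i

/-- There is a `j`-dimensional subspace of the form domain on which the quadratic form is at most
`E` times the squared `L²`-norm. -/
def HasTrialSpace (a : C(ℝ, ℝ)) (j : ℕ) (E : ℝ) : Prop :=
  ∃ W : Submodule ℂ (formDomain a), Module.finrank ℂ W = j ∧
    ∀ p ∈ W, ‖p‖ ^ 2 ≤ (E + 1) * ‖formEmbedding a p‖ ^ 2

theorem schrodingerOp_apply_eq_iff (V : C(ℝ, ℝ)) (u f : L2R) :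
    (∃ hu : u ∈ (schrodingerOp V).domain, schrodingerOp V ⟨u, hu⟩ = f)
      ↔ (u, f) ∈ schrodingerGraph V := by
  rw [← schrodingerOp_graph, LinearPMap.mem_graph_iff]
  constructor
  · rintro ⟨hu, h⟩
    exact ⟨⟨u, hu⟩, rfl, h⟩
  · rintro ⟨⟨y, hy⟩, rfl, h⟩
    exact ⟨hy, h⟩

theorem norm_formEmbedding_le {a : C(ℝ, ℝ)} (p : formDomain a) : ‖formEmbedding a p‖ ≤ ‖p‖ :=
  PiLp.norm_apply_le (p : FormSpace) 0

/-- The embedding is a contraction, so a nonzero `p` forces E + 1 ≥ 1. This bounds the admissible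
`E` from below and gives √E its meaning. -/
theorem HasTrialSpace.nonneg {a : C(ℝ, ℝ)} {j : ℕ} (hj : 1 ≤ j) {E : ℝ} (h : HasTrialSpace a j E) :
    0 ≤ E := by
  obtain ⟨W, hW, h⟩ := h
  have hne : W ≠ ⊥ := by
    rintro rfl
    rw [finrank_bot] at hW
    omega
  obtain ⟨p, hp, hp0⟩ := (Submodule.ne_bot_iff _).1 hne
  have h1 := h p hp
  have h2 : ‖formEmbedding a p‖ ^ 2 ≤ ‖p‖ ^ 2 := by
    gcongr; exact norm_formEmbedding_le p
  have h3 : 0 < ‖p‖ ^ 2 := by positivity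
  by_contra hE
  have h4 : 0 < ‖formEmbedding a p‖ ^ 2 := by
    refine lt_of_le_of_ne (sq_nonneg _) fun h => ?_
    rw [← h, mul_zero] at h1
    linarith
  nlinarith [mul_neg_of_neg_of_pos (not_le.1 hE) h4]

/-- J† carries an eigenvector of H for μ to one of J† J for 1/(μ + 1) ≥ 1/(E + 1), and the span of
these is a trial space. Compactness plays no role in this direction. -/
theorem hasTrialSpace_of_hasEigenvectorsBelow {a : C(ℝ, ℝ)} {j : ℕ} (hj : 1 ≤ j) {E : ℝ}
    (h : HasEigenvectorsBelow (schrodingerOp (a ^ 2)) j E) : HasTrialSpace a j E := by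
  obtain ⟨v, hv, h⟩ := h
  set J := formEmbedding a with hJ
  choose μ hμE hμ using h
  have hgr : ∀ i, v i = ((μ i + 1 : ℝ) : ℂ) • J (ContinuousLinearMap.adjoint J (v i)) := fun i =>
    eq_smul_resolvent_of_mem_graph ((schrodingerOp_apply_eq_iff _ _ _).1 (hμ i))
  have hpos : ∀ i, 0 < μ i + 1 := by
    intro i
    have h2 := norm_sq_eq_of_eq_smul_comp_adjoint J (hgr i)
    have h3 : 0 < ‖v i‖ ^ 2 := by
      have := hv.ne_zero i
      positivity
    by_contra hcon
    nlinarith [sq_nonneg ‖ContinuousLinearMap.adjoint J (v i)‖]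
  have hne : ∀ i, ((μ i + 1 : ℝ) : ℂ) ≠ 0 := fun i => by exact_mod_cast (hpos i).ne'
  set g : Fin j → formDomain a := fun i => ContinuousLinearMap.adjoint J (v i) with hg
  have hJg : ∀ i, J (g i) = ((μ i + 1 : ℝ) : ℂ)⁻¹ • v i := fun i => by
    rw [eq_inv_smul_iff₀ (hne i)]; exact (hgr i).symm
  -- J sends each `g i` to a nonzero multiple of `v i`, so independence lifts back along J.
  have hgi : LinearIndependent ℂ g := by
    refine LinearIndependent.of_comp (J : formDomain a →ₗ[ℂ] L2R) ?_
    convert hv.units_smul (fun i => (Units.mk0 _ (hne i))⁻¹) using 1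
    ext1 i
    exact hJg i
  have hE : 0 < E + 1 := by linarith [hpos ⟨0, hj⟩, hμE ⟨0, hj⟩]
  refine ⟨Submodule.span ℂ (Set.range g), ?_, fun p hp => ?_⟩
  · rw [finrank_span_eq_card hgi, Fintype.card_fin]
  · have := le_on_span_of_eigenvectors J (c := 1 / (E + 1)) (v := g) (fun i => by
      refine ⟨1 / (μ i + 1), one_div_le_one_div_of_le (hpos i) (by linarith [hμE i]), ?_⟩
      rw [hJg, map_smul, one_div, Complex.ofReal_inv]) hp
    rwa [one_div, inv_mul_le_iff₀ hE] at this

/-- On the trial space ‖J p‖² ≥ ‖p‖²/(E + 1), so max-min provides `j` eigenvectors of J† J with l ≥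
1/(E + 1); their images under J have eigenvalues 1/l - 1 ≤ E. -/
theorem HasTrialSpace.hasEigenvectorsBelow {a : C(ℝ, ℝ)} (hc : IsCompactOperator (formEmbedding a))
    {j : ℕ} (hj : 1 ≤ j) {E : ℝ} (h : HasTrialSpace a j E) :
    HasEigenvectorsBelow (schrodingerOp (a ^ 2)) j E := by
  have hE0 := h.nonneg hj
  have hE : 0 < E + 1 := by linarith
  obtain ⟨W, hW, h⟩ := h
  have : FiniteDimensional ℂ W := Module.finite_of_finrank_pos (by omega)
  set J := formEmbedding a with hJ
  have hc0 : (0 : ℝ) < 1 / (E + 1) := by positivity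
  obtain ⟨v, hv0, hv1, hv2⟩ := exists_eigenvectors_of_le_on_subspace hc hc0 W
    (fun u hu => by rw [one_div, inv_mul_le_iff₀ hE]; exact h u hu) hW.ge
  -- J preserves orthogonality and nonvanishing of these eigenvectors, hence their images are
  -- independent.
  have hinner : ∀ i k, ∃ l : ℝ, 0 < l ∧ inner ℂ (J (v i)) (J (v k)) = l * inner ℂ (v i) (v k) := by
    intro i k
    obtain ⟨l, hl, h⟩ := hv2 k
    refine ⟨l, hc0.trans_le hl, ?_⟩
    rw [← ContinuousLinearMap.adjoint_inner_right, h, inner_smul_right]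
  refine ⟨fun i => J (v i), linearIndependent_of_ne_zero_of_inner_eq_zero (fun i h0 => ?_)
    (fun i k hik => ?_), fun i => ?_⟩
  · obtain ⟨l, hl, h⟩ := hinner i i
    rw [h0, inner_zero_left] at h
    have hl' : (l : ℂ) ≠ 0 := by exact_mod_cast hl.ne'
    exact hv0 i (inner_self_eq_zero.1 ((mul_eq_zero.1 h.symm).resolve_left hl'))
  · obtain ⟨l, hl, h⟩ := hinner i k
    change inner ℂ (J (v i)) (J (v k)) = 0
    rw [h, hv1 hik, mul_zero]
  · obtain ⟨l, hl, h⟩ := hv2 i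
    have hl0 := hc0.trans_le hl
    refine ⟨1 / l - 1, ?_, (schrodingerOp_apply_eq_iff _ _ _).2
      (mem_graph_of_eigenvector hl0.ne' h)⟩
    have := one_div_le_one_div_of_le hc0 hl
    rw [one_div_one_div] at this
    linarith

end FormDomain

/-! ### Compactness of the form embedding. -/

section Compactness

/-- An operator which is small on closed subspaces of finite codimension is compact. -/
theorem isCompactOperator_of_small_on_finite_codim {X L : Type*} [NormedAddCommGroup X]
    [InnerProductSpace ℂ X] [CompleteSpace X] [NormedAddCommGroup L] [InnerProductSpace ℂ L]
    [CompleteSpace L] (J : X →L[ℂ] L)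
    (h : ∀ η : ℝ, 0 < η → ∃ (n : ℕ) (l : Fin n → X →L[ℂ] ℂ), ∀ u, (∀ i, l i u = 0) →
      ‖J u‖ ≤ η * ‖u‖) : IsCompactOperator J := by
  have hcl := isClosed_setOfPred_isCompactOperator (σ₁₂ := RingHom.id ℂ) (M₁ := X) (M₂ := L)
  refine hcl.closure_subset (Metric.mem_closure_iff.2 fun e he => ?_)
  obtain ⟨n, l, hl⟩ := h (e / 2) (by positivity)
  let Λ : X →L[ℂ] (Fin n → ℂ) := ContinuousLinearMap.pi l
  set M : Submodule ℂ X := LinearMap.ker (Λ : X →ₗ[ℂ] (Fin n → ℂ)) with hM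
  have hMc : IsClosed (M : Set X) := Λ.isClosed_ker
  have : CompleteSpace M := hMc.completeSpace_coe
  have hfin : FiniteDimensional ℂ Mᗮ := by
    refine FiniteDimensional.of_injective ((Λ : X →ₗ[ℂ] (Fin n → ℂ)) ∘ₗ Mᗮ.subtype) ?_
    rw [← LinearMap.ker_eq_bot, LinearMap.ker_eq_bot']
    intro m hm
    have h1 : (m : X) ∈ M := hm
    have h2 := (Submodule.mem_orthogonal _ _).1 m.2 _ h1
    exact Subtype.ext (inner_self_eq_zero.1 h2)
  have : ProperSpace Mᗮ := FiniteDimensional.proper ℂ Mᗮ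
  let Q : X →L[ℂ] Mᗮ := Mᗮ.orthogonalProjectionOnto
  -- The approximant is J after the projection onto the finite-dimensional `Mᗮ`; the error is J
  -- after the projection onto `M`, where J is small.
  refine ⟨(J ∘L Mᗮ.subtypeL) ∘L Q, ?_, ?_⟩
  · have h1 : IsCompactOperator (J ∘L Mᗮ.subtypeL : Mᗮ →L[ℂ] L) :=
      isCompactOperator_of_locallyCompactSpace_rng (J ∘L Mᗮ.subtypeL : Mᗮ →L[ℂ] L)
    exact h1.comp_clm Q
  · rw [dist_eq_norm]
    refine lt_of_le_of_lt (ContinuousLinearMap.opNorm_le_bound _ (by positivity : 0 ≤ e / 2)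
      fun u => ?_) (by linarith : e / 2 < e)
    have hu : (J - (J ∘L Mᗮ.subtypeL) ∘L Q) u = J (M.starProjection u) := by
      have h1 : u = M.starProjection u + Mᗮ.starProjection u :=
        (M.starProjection_add_starProjection_orthogonal u).symm
      have h2 : J u = J (M.starProjection u) + J (Mᗮ.starProjection u) := by
        rw [← map_add, ← h1]
      change J u - J (Mᗮ.starProjection u) = _
      rw [h2, add_sub_cancel_right]
    rw [hu]
    have h3 : M.starProjection u ∈ M := M.starProjection_apply_mem u
    refine (hl _ fun i => congrFun h3 i).trans ?_
    gcongr
    exact M.norm_starProjection_apply_le u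

theorem integrable_norm_sq_L2R (u : L2R) : Integrable (fun x => ‖u x‖ ^ 2) volume :=
  (Lp.memLp u).norm.integrable_sq

theorem norm_sq_L2R (u : L2R) : ‖u‖ ^ 2 = ∫ x, ‖u x‖ ^ 2 := by
  rw [← inner_self_eq_norm_sq (𝕜 := ℂ) u, L2.inner_def, ← integral_re (L2.integrable_inner u u)]
  exact integral_congr_ae (Filter.Eventually.of_forall fun x => inner_self_eq_norm_sq (𝕜 := ℂ) (u x))

theorem norm_sq_formSpace (p : FormSpace) : ‖p‖ ^ 2 = ‖p 0‖ ^ 2 + ‖p 1‖ ^ 2 + ‖p 2‖ ^ 2 := by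
  rw [PiLp.norm_sq_eq_of_L2, Fin.sum_univ_three]

/-- The Cauchy–Schwarz inequality on an interval. -/
theorem sq_intervalIntegral_le {g : ℝ → ℝ} (hg : Continuous g) {a b : ℝ} (hab : a < b) :
    (∫ x in a..b, g x) ^ 2 ≤ (b - a) * ∫ x in a..b, g x ^ 2 := by
  have hh : 0 < b - a := sub_pos.2 hab
  set A := ∫ x in a..b, g x with hA
  -- The variance of `g` about its mean is nonnegative.
  have h1 : 0 ≤ ∫ x in a..b, (g x - A / (b - a)) ^ 2 :=
    intervalIntegral.integral_nonneg hab.le fun x _ => sq_nonneg _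
  have h2 : ∫ x in a..b, (g x - A / (b - a)) ^ 2
      = (∫ x in a..b, g x ^ 2) - 2 * (A / (b - a)) * A + (b - a) * (A / (b - a)) ^ 2 := by
    have e : ∀ x, (g x - A / (b - a)) ^ 2
        = g x ^ 2 - 2 * (A / (b - a)) * g x + (A / (b - a)) ^ 2 := fun x => by ring
    simp_rw [e]
    rw [intervalIntegral.integral_add (Continuous.intervalIntegrable (by fun_prop) _ _)
      (Continuous.intervalIntegrable (by fun_prop) _ _),
      intervalIntegral.integral_sub (Continuous.intervalIntegrable (by fun_prop) _ _)
      (Continuous.intervalIntegrable (by fun_prop) _ _), intervalIntegral.integral_const_mul,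
      intervalIntegral.integral_const, smul_eq_mul]
  rw [h2] at h1
  have h3 : (∫ x in a..b, g x ^ 2) - 2 * (A / (b - a)) * A + (b - a) * (A / (b - a)) ^ 2
      = (∫ x in a..b, g x ^ 2) - A ^ 2 / (b - a) := by
    field_simp; ring
  rw [h3, sub_nonneg, div_le_iff₀ hh] at h1
  linarith

/-- The Poincaré inequality on an interval. -/
theorem intervalIntegral_norm_sq_le {f : ℝ → ℂ} (hf : ContDiff ℝ 1 f) {a b : ℝ} (hab : a < b) :
    ∫ x in a..b, ‖f x‖ ^ 2 ≤ 2 * (b - a) ^ 2 * (∫ x in a..b, ‖deriv f x‖ ^ 2)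
      + 2 / (b - a) * ‖∫ x in a..b, f x‖ ^ 2 := by
  have hh : 0 < b - a := sub_pos.2 hab
  have hfc := hf.continuous
  have hdc : Continuous (deriv f) := hf.continuous_deriv le_rfl
  set D := ∫ x in a..b, ‖deriv f x‖ with hD
  have hD0 : 0 ≤ D := intervalIntegral.integral_nonneg hab.le fun x _ => norm_nonneg _
  have hosc : ∀ x ∈ Set.Icc a b, ∀ t ∈ Set.Icc a b, ‖f x - f t‖ ≤ D := by
    intro x hx t ht
    have e : ∫ y in t..x, deriv f y = f x - f t :=
      intervalIntegral.integral_deriv_eq_sub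
        (fun y _ => (hf.differentiable one_ne_zero).differentiableAt)
        (hdc.intervalIntegrable _ _)
    rw [← e]
    refine intervalIntegral.norm_integral_le_abs_integral_norm.trans ?_
    refine (intervalIntegral.abs_integral_mono_interval (c := a) (d := b) ?_
      (Filter.Eventually.of_forall fun _ => norm_nonneg _)
      (hdc.norm.intervalIntegrable _ _)).trans (abs_of_nonneg hD0).le
    rw [Set.uIoc_of_le hab.le]
    intro y hy
    rcases Set.mem_uIoc.1 hy with h | h
    · exact ⟨ht.1.trans_lt h.1, h.2.trans hx.2⟩
    · exact ⟨hx.1.trans_lt h.1, h.2.trans ht.2⟩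
  set m := ‖∫ x in a..b, f x‖ with hm
  -- f(x) is the mean of `f` plus the mean over t of f(x) - f(t), and the oscillation is at most
  -- `D`. Squaring later costs the factor 2.
  have hpt : ∀ x ∈ Set.Icc a b, ‖f x‖ ≤ D + m / (b - a) := by
    intro x hx
    have h1 : ((b - a : ℝ) : ℂ) * f x = (∫ t in a..b, (f x - f t)) + ∫ t in a..b, f t := by
      rw [intervalIntegral.integral_sub (continuous_const.intervalIntegrable _ _)
        (hfc.intervalIntegrable _ _), sub_add_cancel, intervalIntegral.integral_const,
        Complex.real_smul]
    have h2 : ‖∫ t in a..b, (f x - f t)‖ ≤ D * |b - a| :=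
      intervalIntegral.norm_integral_le_of_norm_le_const fun t ht => by
        rw [Set.uIoc_of_le hab.le] at ht
        exact hosc x hx t ⟨ht.1.le, ht.2⟩
    have h3 : (b - a) * ‖f x‖ ≤ D * (b - a) + m := by
      rw [abs_of_pos hh] at h2
      calc (b - a) * ‖f x‖ = ‖((b - a : ℝ) : ℂ) * f x‖ := by
            rw [norm_mul, Complex.norm_real, Real.norm_of_nonneg hh.le]
        _ ≤ D * (b - a) + m := by
            rw [h1]; exact (norm_add_le _ _).trans (add_le_add_left h2 _)
    have h4 : (D + m / (b - a)) * (b - a) = D * (b - a) + m := by field_simp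
    nlinarith
  have hD2 : D ^ 2 ≤ (b - a) * ∫ x in a..b, ‖deriv f x‖ ^ 2 := sq_intervalIntegral_le hdc.norm hab
  have hint : ∫ x in a..b, ‖f x‖ ^ 2 ≤ ∫ _ in a..b, (2 * D ^ 2 + 2 * (m / (b - a)) ^ 2) := by
    refine intervalIntegral.integral_mono_on hab.le
      (Continuous.intervalIntegrable (by fun_prop) _ _) (continuous_const.intervalIntegrable _ _)
      fun x hx => ?_
    have h1 := hpt x hx
    have h2 : ‖f x‖ ^ 2 ≤ (D + m / (b - a)) ^ 2 := by gcongr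
    nlinarith [sq_nonneg (D - m / (b - a))]
  refine hint.trans ?_
  rw [intervalIntegral.integral_const, smul_eq_mul]
  have e : (b - a) * (2 * D ^ 2 + 2 * (m / (b - a)) ^ 2)
      = 2 * (b - a) * D ^ 2 + 2 / (b - a) * m ^ 2 := by field_simp
  rw [e]
  have := mul_le_mul_of_nonneg_left hD2 (by positivity : 0 ≤ 2 * (b - a))
  nlinarith

/-- The functional `p ↦ ∫_c^d p₀` on the form space. -/
noncomputable def intervalFunctional (c d : ℝ) : FormSpace →L[ℂ] ℂ :=
  innerSL ℂ (indicatorConstLp 2 (measurableSet_Ioc (a := c) (b := d))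
    (by simp) (1 : ℂ)) ∘L (PiLp.proj 2 (fun _ : Fin 3 => L2R) 0 : FormSpace →L[ℂ] L2R)

theorem intervalFunctional_apply {c d : ℝ} (hcd : c ≤ d) (p : FormSpace) :
    intervalFunctional c d p = ∫ x in c..d, p 0 x := by
  rw [intervalIntegral.integral_of_le hcd]
  exact L2.inner_indicatorConstLp_one _ _ _

/-- Inside [-R, R] the Poincaré inequality is applied on `n` cells of length `h`; outside, |f|² ≤ |a
f|²/m². Only the finitely many cell integrals obstruct smallness. -/
theorem norm_sq_le_of_mem_formDomain {a : C(ℝ, ℝ)} {p : FormSpace} (hp : p ∈ formDomain a)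
    {m R h : ℝ} {n : ℕ} (hm : 0 < m) (hR : ∀ x, R ≤ |x| → m ≤ |a x|) (hh : 0 < h)
    (hn : n * h = 2 * R) :
    ‖p 0‖ ^ 2 ≤ (2 * h ^ 2) * ‖p 1‖ ^ 2 + (1 / m ^ 2) * ‖p 2‖ ^ 2
      + 2 / h * ∑ i ∈ Finset.range n,
        ‖intervalFunctional (-R + i * h) (-R + (i + 1 : ℕ) * h) p‖ ^ 2 := by
  have hcl : IsClosed {p : FormSpace | ‖p 0‖ ^ 2 ≤ (2 * h ^ 2) * ‖p 1‖ ^ 2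
      + (1 / m ^ 2) * ‖p 2‖ ^ 2 + 2 / h * ∑ i ∈ Finset.range n,
        ‖intervalFunctional (-R + i * h) (-R + (i + 1 : ℕ) * h) p‖ ^ 2} :=
    isClosed_le (by fun_prop) (by fun_prop)
  refine closure_minimal ?_ hcl hp
  rintro p ⟨f, hf, f0, f1, f2⟩
  change ‖p 0‖ ^ 2 ≤ _
  have hfc := hf.continuous
  have hdc : Continuous (deriv f) := hf.continuous_deriv le_rfl
  have e0 : ‖p 0‖ ^ 2 = ∫ x, ‖f x‖ ^ 2 := by
    rw [norm_sq_L2R]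
    exact integral_congr_ae (by filter_upwards [f0] with x hx; rw [hx])
  have e1 : ‖p 1‖ ^ 2 = ∫ x, ‖deriv f x‖ ^ 2 := by
    rw [norm_sq_L2R]
    exact integral_congr_ae (by filter_upwards [f1] with x hx; rw [hx])
  have e2 : ‖p 2‖ ^ 2 = ∫ x, ‖(a x : ℂ) * f x‖ ^ 2 := by
    rw [norm_sq_L2R]
    exact integral_congr_ae (by filter_upwards [f2] with x hx; rw [hx])
  have i0 : Integrable (fun x => ‖f x‖ ^ 2) volume :=
    (integrable_norm_sq_L2R (p 0)).congr (by filter_upwards [f0] with x hx; rw [hx])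
  have i1 : Integrable (fun x => ‖deriv f x‖ ^ 2) volume :=
    (integrable_norm_sq_L2R (p 1)).congr (by filter_upwards [f1] with x hx; rw [hx])
  have i2 : Integrable (fun x => ‖(a x : ℂ) * f x‖ ^ 2) volume :=
    (integrable_norm_sq_L2R (p 2)).congr (by filter_upwards [f2] with x hx; rw [hx])
  have hR0 : 0 ≤ R := by
    have : (0 : ℝ) ≤ n * h := by positivity
    linarith
  set c : ℕ → ℝ := fun i => -R + i * h with hc
  have hc0 : c 0 = -R := by simp [hc]
  have hcn : c n = R := by simp only [hc]; linarith
  have hcs : ∀ i, c (i + 1) - c i = h := fun i => by simp only [hc]; push_cast; ring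
  have hsplit : ∀ g : ℝ → ℝ, Continuous g →
      ∑ i ∈ Finset.range n, ∫ x in c i..c (i + 1), g x = ∫ x in Set.Ioc (-R) R, g x := by
    intro g hg
    rw [intervalIntegral.sum_integral_adjacent_intervals
      (fun i _ => hg.intervalIntegrable _ _), hc0, hcn,
      intervalIntegral.integral_of_le (by linarith)]
  have hin : ∫ x in Set.Ioc (-R) R, ‖f x‖ ^ 2 ≤ (2 * h ^ 2) * ‖p 1‖ ^ 2
      + 2 / h * ∑ i ∈ Finset.range n,
        ‖intervalFunctional (-R + i * h) (-R + (i + 1 : ℕ) * h) p‖ ^ 2 := by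
    have h1 : ∫ x in Set.Ioc (-R) R, ‖deriv f x‖ ^ 2 ≤ ‖p 1‖ ^ 2 := by
      rw [e1]
      exact setIntegral_le_integral i1 (Filter.Eventually.of_forall fun x => sq_nonneg _)
    rw [← hsplit _ (by fun_prop)]
    have h2 : ∑ i ∈ Finset.range n, ∫ x in c i..c (i + 1), ‖f x‖ ^ 2
        ≤ ∑ i ∈ Finset.range n, (2 * h ^ 2 * (∫ x in c i..c (i + 1), ‖deriv f x‖ ^ 2)
          + 2 / h * ‖intervalFunctional (c i) (c (i + 1)) p‖ ^ 2) := by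
      refine Finset.sum_le_sum fun i _ => ?_
      have hlt : c i < c (i + 1) := by linarith [hcs i]
      have h3 := intervalIntegral_norm_sq_le hf hlt
      rw [hcs] at h3
      have h4 : intervalFunctional (c i) (c (i + 1)) p = ∫ x in c i..c (i + 1), f x := by
        rw [intervalFunctional_apply hlt.le]
        exact intervalIntegral.integral_congr_ae (by filter_upwards [f0] with x hx _; rw [hx])
      rw [h4]
      exact h3
    refine h2.trans ?_
    rw [Finset.sum_add_distrib, ← Finset.mul_sum, ← Finset.mul_sum, hsplit _ (by fun_prop)]
    gcongr
  have hout : ∫ x in (Set.Ioc (-R) R)ᶜ, ‖f x‖ ^ 2 ≤ (1 / m ^ 2) * ‖p 2‖ ^ 2 := by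
    have h1 : ∫ x in (Set.Ioc (-R) R)ᶜ, ‖f x‖ ^ 2
        ≤ ∫ x in (Set.Ioc (-R) R)ᶜ, (1 / m ^ 2) * ‖(a x : ℂ) * f x‖ ^ 2 := by
      refine setIntegral_mono_on i0.integrableOn (i2.const_mul _).integrableOn
        measurableSet_Ioc.compl fun x hx => ?_
      have hx' : R ≤ |x| := by
        by_contra hcon
        have := abs_lt.1 (not_le.1 hcon)
        exact hx ⟨this.1, this.2.le⟩
      have h3 : m ^ 2 ≤ |a x| ^ 2 := by
        gcongr
        exact hR x hx'
      rw [norm_mul, Complex.norm_real, Real.norm_eq_abs, mul_pow, div_mul_eq_mul_div, one_mul,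
        le_div_iff₀ (by positivity), mul_comm]
      gcongr
    refine h1.trans ?_
    rw [integral_const_mul, e2]
    exact mul_le_mul_of_nonneg_left
      (setIntegral_le_integral i2 (Filter.Eventually.of_forall fun x => sq_nonneg _))
      (by positivity)
  have htot := integral_add_compl (measurableSet_Ioc (a := -R) (b := R)) i0
  rw [e0, ← htot]
  linarith

/-- If `|a| → ∞` then the form domain is compactly embedded in `L²(ℝ)`. -/
theorem isCompactOperator_formEmbedding {a : C(ℝ, ℝ)}
    (ha : ∀ m : ℝ, ∃ R : ℝ, ∀ x, R ≤ |x| → m ≤ |a x|) : IsCompactOperator (formEmbedding a) := by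
  refine isCompactOperator_of_small_on_finite_codim _ fun η hη => ?_
  -- With m = 1/η and h ≤ η/2, both coefficients 1/m² and 2 h² are at most η². Taking `R` at least 1
  -- keeps the cell length positive.
  obtain ⟨R', hR'⟩ := ha (1 / η)
  set R := max R' 1 with hRdef
  have hR1 : 1 ≤ R := le_max_right _ _
  obtain ⟨n, hn⟩ := exists_nat_gt (2 * R / (η / 2))
  have hn0 : (0 : ℝ) < n := lt_trans (by positivity) hn
  set h := 2 * R / n with hh
  have hhpos : 0 < h := by positivity
  have hhη : h ≤ η / 2 := by
    rw [hh, div_le_iff₀ hn0]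
    rw [div_lt_iff₀ (by positivity)] at hn
    linarith
  refine ⟨n, fun i => intervalFunctional (-R + (i : ℕ) * h) (-R + ((i : ℕ) + 1 : ℕ) * h) ∘L
    (formDomain a).subtypeL, fun u hu => ?_⟩
  have h1 := norm_sq_le_of_mem_formDomain u.2 (m := 1 / η) (R := R) (h := h) (n := n)
    (by positivity) (fun x hx => hR' x ((le_max_left _ _).trans hx)) hhpos
    (by rw [hh]; field_simp)
  have h2 : ∑ i ∈ Finset.range n,
      ‖intervalFunctional (-R + i * h) (-R + (i + 1 : ℕ) * h) (u : FormSpace)‖ ^ 2 = 0 := by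
    refine Finset.sum_eq_zero fun i hi => ?_
    have := hu ⟨i, Finset.mem_range.1 hi⟩
    change intervalFunctional (-R + i * h) (-R + (i + 1 : ℕ) * h) (u : FormSpace) = 0 at this
    rw [this, norm_zero, zero_pow two_ne_zero]
  rw [h2, mul_zero, add_zero] at h1
  have h3 : ‖u‖ ^ 2 = _ := norm_sq_formSpace (u : FormSpace)
  have h4 : 2 * h ^ 2 ≤ η ^ 2 := by nlinarith
  have h5 : 1 / (1 / η) ^ 2 = η ^ 2 := by field_simp
  rw [h5] at h1
  refine le_of_sq_le_sq ?_ (by positivity)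
  rw [mul_pow, h3]
  change ‖(u : FormSpace) 0‖ ^ 2 ≤ _
  nlinarith [sq_nonneg ‖(u : FormSpace) 0‖, sq_nonneg ‖(u : FormSpace) 1‖,
    mul_le_mul_of_nonneg_right h4 (sq_nonneg ‖(u : FormSpace) 1‖), sq_nonneg η,
    mul_nonneg (sq_nonneg η) (sq_nonneg ‖(u : FormSpace) 0‖)]

end Compactness

/-! ### Gaussian-weighted polynomials and the oscillator trial space. -/

section GaussianTrialSpace

open Polynomial

/-- Polynomials are integrable against the Gaussian weight `exp (-b x²)`. -/
theorem integrable_eval_mul_gaussian {b : ℝ} (hb : 0 < b) (p : ℂ[X]) :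
    Integrable (fun x : ℝ => p.eval (x : ℂ) * (Real.exp (-b * x ^ 2) : ℂ)) volume := by
  induction p using Polynomial.induction_on' with
  | add p q hp hq =>
    refine (hp.add hq).congr (Filter.Eventually.of_forall fun x => ?_)
    simp [add_mul]
  | monomial n c =>
    have h : Integrable (fun x : ℝ => x ^ n * Real.exp (-b * x ^ 2)) volume := by
      have := integrable_rpow_mul_exp_neg_mul_sq hb (s := n)
        (by linarith [(Nat.cast_nonneg n : (0 : ℝ) ≤ n)])
      simpa using this
    refine (h.ofReal.const_mul c).congr (Filter.Eventually.of_forall fun x => ?_)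
    simp [mul_assoc]

/-- The linear functional `p ↦ ∫ p(x) exp (-b x²) dx` on complex polynomials. -/
noncomputable def gaussianIntegral {b : ℝ} (hb : 0 < b) : ℂ[X] →ₗ[ℂ] ℂ where
  toFun p := ∫ x : ℝ, p.eval (x : ℂ) * (Real.exp (-b * x ^ 2) : ℂ)
  map_add' p q := by
    rw [← integral_add (integrable_eval_mul_gaussian hb p) (integrable_eval_mul_gaussian hb q)]
    simp [add_mul]
  map_smul' c p := by
    rw [RingHom.id_apply, smul_eq_mul, ← integral_const_mul]
    simp [mul_assoc]

/-- The squared norm of a polynomial in the weighted space `L²(exp (-b x²) dx)`. -/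
noncomputable def gaussianNormSq (b : ℝ) (p : ℂ[X]) : ℝ :=
  ∫ x : ℝ, ‖p.eval (x : ℂ)‖ ^ 2 * Real.exp (-b * x ^ 2)

theorem gaussianNormSq_nonneg (b : ℝ) (p : ℂ[X]) : 0 ≤ gaussianNormSq b p :=
  integral_nonneg fun _ => by positivity

/-- The polynomial with conjugate coefficients. -/
noncomputable def conjPoly (p : ℂ[X]) : ℂ[X] := p.map (starRingEnd ℂ)

theorem eval_conjPoly (p : ℂ[X]) (x : ℝ) :
    (conjPoly p).eval (x : ℂ) = starRingEnd ℂ (p.eval (x : ℂ)) := by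
  rw [conjPoly, eval_map, ← Complex.conj_ofReal x, eval₂_at_apply, Complex.conj_ofReal]

theorem eval_conjPoly_mul_self (p : ℂ[X]) (x : ℝ) :
    (conjPoly p * p).eval (x : ℂ) = ((‖p.eval (x : ℂ)‖ ^ 2 : ℝ) : ℂ) := by
  rw [eval_mul, eval_conjPoly, mul_comm, Complex.mul_conj, Complex.normSq_eq_norm_sq]

theorem integrable_norm_sq_mul_gaussian {b : ℝ} (hb : 0 < b) (p : ℂ[X]) :
    Integrable (fun x : ℝ => ‖p.eval (x : ℂ)‖ ^ 2 * Real.exp (-b * x ^ 2)) volume := by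
  refine (integrable_eval_mul_gaussian hb (conjPoly p * p)).re.congr
    (Filter.Eventually.of_forall fun x => ?_)
  change Complex.re _ = _
  rw [eval_conjPoly_mul_self, ← Complex.ofReal_mul, Complex.ofReal_re]

theorem gaussianIntegral_conj_mul_self {b : ℝ} (hb : 0 < b) (p : ℂ[X]) :
    gaussianIntegral hb (conjPoly p * p) = gaussianNormSq b p := by
  rw [gaussianNormSq, ← integral_complex_ofReal]
  refine integral_congr_ae (Filter.Eventually.of_forall fun x => ?_)
  change (conjPoly p * p).eval (x : ℂ) * _ = _
  rw [eval_conjPoly_mul_self, ← Complex.ofReal_mul]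

theorem hasDerivAt_eval_ofReal (p : ℂ[X]) (x : ℝ) :
    HasDerivAt (fun x : ℝ => p.eval (x : ℂ)) (p.derivative.eval (x : ℂ)) x :=
  (p.hasDerivAt (x : ℂ)).comp_ofReal

theorem hasDerivAt_gaussian (b x : ℝ) :
    HasDerivAt (fun x : ℝ => (Real.exp (-b * x ^ 2) : ℂ))
      ((-(2 * b * x) : ℝ) * (Real.exp (-b * x ^ 2) : ℂ)) x := by
  have h : HasDerivAt (fun x : ℝ => Real.exp (-b * x ^ 2))
      (-(2 * b * x) * Real.exp (-b * x ^ 2)) x := by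
    convert! (((hasDerivAt_id x).pow 2).const_mul (-b)).exp using 1
    simp only [id, Pi.pow_apply, Nat.cast_ofNat, Nat.add_one_sub_one, pow_one, mul_one]
    ring
  convert h.ofReal_comp using 1
  push_cast; ring

/-- Integration by parts against the Gaussian weight. -/
theorem gaussianIntegral_derivative {b : ℝ} (hb : 0 < b) (p : ℂ[X]) :
    gaussianIntegral hb (derivative p) = 2 * b * gaussianIntegral hb (X * p) := by
  have hd : ∀ x : ℝ, HasDerivAt (fun x : ℝ => p.eval (x : ℂ) * (Real.exp (-b * x ^ 2) : ℂ))
      ((derivative p - C (2 * b : ℂ) * (X * p)).eval (x : ℂ) * (Real.exp (-b * x ^ 2) : ℂ)) x := by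
    intro x
    convert! (hasDerivAt_eval_ofReal p x).mul (hasDerivAt_gaussian b x) using 1
    simp
    ring
  have h : gaussianIntegral hb (derivative p - C (2 * b : ℂ) * (X * p)) = 0 :=
    integral_eq_zero_of_hasDerivAt_of_integrable hd (integrable_eval_mul_gaussian hb _)
      (integrable_eval_mul_gaussian hb _)
  rw [map_sub, ← smul_eq_C_mul, map_smul, smul_eq_mul] at h
  linear_combination h

theorem conjPoly_mul (p q : ℂ[X]) : conjPoly (p * q) = conjPoly p * conjPoly q := by
  simp [conjPoly]

theorem conjPoly_sub (p q : ℂ[X]) : conjPoly (p - q) = conjPoly p - conjPoly q := by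
  simp [conjPoly]

theorem conjPoly_X : conjPoly X = X := by simp [conjPoly]

theorem conjPoly_C_ofReal (t : ℝ) : conjPoly (C (t : ℂ)) = C (t : ℂ) := by simp [conjPoly]

theorem conjPoly_derivative (p : ℂ[X]) : conjPoly (derivative p) = derivative (conjPoly p) := by
  simp [conjPoly, derivative_map]

theorem gaussianIntegral_C_mul {b : ℝ} (hb : 0 < b) (c : ℂ) (p : ℂ[X]) :
    gaussianIntegral hb (C c * p) = c * gaussianIntegral hb p := by
  rw [← smul_eq_C_mul, map_smul, smul_eq_mul]

/-- The Hermite operator `p ↦ -p'' + 2 b x p'`. -/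
noncomputable def hermiteOp (b : ℝ) (p : ℂ[X]) : ℂ[X] :=
  C ((2 * b : ℝ) : ℂ) * (X * derivative p) - derivative (derivative p)

/-- Integration by parts of p q': in the weighted space the Hermite operator is D† D, with D the
derivative. -/
theorem gaussianIntegral_mul_hermiteOp {b : ℝ} (hb : 0 < b) (p q : ℂ[X]) :
    gaussianIntegral hb (p * hermiteOp b q)
      = gaussianIntegral hb (derivative p * derivative q) := by
  have h := gaussianIntegral_derivative hb (p * derivative q)
  rw [derivative_mul, map_add] at h
  have e : p * hermiteOp b q = C ((2 * b : ℝ) : ℂ) * (X * (p * derivative q))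
      - p * derivative (derivative q) := by
    rw [hermiteOp]; ring
  rw [e, map_sub, gaussianIntegral_C_mul]
  push_cast
  linear_combination -h

theorem derivative_hermiteOp (b : ℝ) (p : ℂ[X]) :
    derivative (hermiteOp b p)
      = hermiteOp b (derivative p) + C ((2 * b : ℝ) : ℂ) * derivative p := by
  simp only [hermiteOp, derivative_sub, derivative_mul, derivative_C, derivative_X]
  ring

theorem conjPoly_hermiteOp (b : ℝ) (p : ℂ[X]) :
    conjPoly (hermiteOp b p) = hermiteOp b (conjPoly p) := by
  rw [hermiteOp, conjPoly_sub, conjPoly_mul, conjPoly_mul, conjPoly_X, conjPoly_C_ofReal,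
    conjPoly_derivative, conjPoly_derivative, conjPoly_derivative, hermiteOp]

/-- Expand the square. The form identity gives the cross terms, and the commutation rule
`derivative_hermiteOp` turns ‖L p‖² into ‖p''‖² + 2b ‖p'‖², where L is the Hermite operator. -/
theorem gaussianNormSq_hermiteOp_sub {b : ℝ} (hb : 0 < b) (p : ℂ[X]) (t : ℝ) :
    gaussianNormSq b (hermiteOp b p - C (t : ℂ) * p)
      = gaussianNormSq b (derivative (derivative p)) + 2 * b * gaussianNormSq b (derivative p)
        - 2 * t * gaussianNormSq b (derivative p) + t ^ 2 * gaussianNormSq b p := by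
  apply Complex.ofReal_injective
  push_cast
  rw [← gaussianIntegral_conj_mul_self hb, ← gaussianIntegral_conj_mul_self hb,
    ← gaussianIntegral_conj_mul_self hb, ← gaussianIntegral_conj_mul_self hb]
  rw [conjPoly_sub, conjPoly_mul, conjPoly_C_ofReal, conjPoly_hermiteOp, conjPoly_derivative,
    conjPoly_derivative]
  set q := conjPoly p
  have e : (hermiteOp b q - C (t : ℂ) * q) * (hermiteOp b p - C (t : ℂ) * p)
      = hermiteOp b p * hermiteOp b q - C (t : ℂ) * (p * hermiteOp b q)
        - C (t : ℂ) * (q * hermiteOp b p) + C (t : ℂ) * (C (t : ℂ) * (q * p)) := by ring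
  have h1 := gaussianIntegral_mul_hermiteOp hb (hermiteOp b p) q
  have h2 := gaussianIntegral_mul_hermiteOp hb p q
  have h3 := gaussianIntegral_mul_hermiteOp hb q p
  have h4 := gaussianIntegral_mul_hermiteOp hb (derivative q) (derivative p)
  rw [derivative_hermiteOp, add_mul, map_add, mul_assoc, gaussianIntegral_C_mul,
    mul_comm (hermiteOp b (derivative p)), h4, mul_comm (derivative p)] at h1
  rw [mul_comm (derivative p)] at h2
  rw [e, map_add, map_sub, map_sub, gaussianIntegral_C_mul, gaussianIntegral_C_mul,
    gaussianIntegral_C_mul, gaussianIntegral_C_mul, h1, h2, h3]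
  push_cast
  ring

/-- The sharp Bernstein inequality for polynomials with Gaussian weight. -/
theorem gaussianNormSq_derivative_le {b : ℝ} (hb : 0 < b) (n : ℕ) (p : ℂ[X])
    (hp : p.natDegree ≤ n) :
    gaussianNormSq b (derivative p) ≤ 2 * n * b * gaussianNormSq b p := by
  induction n generalizing p with
  | zero =>
    rw [Nat.le_zero] at hp
    rw [eq_C_of_natDegree_eq_zero hp]
    simp [gaussianNormSq]
  | succ n ih =>
    have h1 := ih (derivative p) ((natDegree_derivative_le p).trans (by omega))
    -- t = 2b(n + 1) is the Hermite eigenvalue in degree n + 1. With ‖p''‖² ≤ 2nb ‖p'‖² from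
    -- induction, the expansion becomes 0 ≤ -t ‖p'‖² + t² ‖p‖².
    have h2 := gaussianNormSq_nonneg b (hermiteOp b p - C ((2 * b * (n + 1) : ℝ) : ℂ) * p)
    rw [gaussianNormSq_hermiteOp_sub hb] at h2
    have ht : 0 < 2 * b * ((n : ℝ) + 1) := by positivity
    have h3 : 2 * b * ((n : ℝ) + 1) * gaussianNormSq b (derivative p)
        ≤ 2 * b * ((n : ℝ) + 1) * (2 * b * ((n : ℝ) + 1) * gaussianNormSq b p) := by
      nlinarith
    have h4 := le_of_mul_le_mul_left h3 ht
    push_cast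
    linarith

/-- The harmonic oscillator form of a polynomial times a Gaussian. -/
theorem gaussianNormSq_oscillator {b : ℝ} (hb : 0 < b) (p : ℂ[X]) :
    gaussianNormSq b (derivative p - C (b : ℂ) * (X * p)) + gaussianNormSq b (C (b : ℂ) * (X * p))
      = gaussianNormSq b (derivative p) + b * gaussianNormSq b p := by
  apply Complex.ofReal_injective
  push_cast
  rw [← gaussianIntegral_conj_mul_self hb, ← gaussianIntegral_conj_mul_self hb,
    ← gaussianIntegral_conj_mul_self hb, ← gaussianIntegral_conj_mul_self hb]
  rw [conjPoly_sub, conjPoly_mul, conjPoly_mul, conjPoly_C_ofReal, conjPoly_derivative, conjPoly_X]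
  set q := conjPoly p
  -- The cross terms -b ∫ x (|p|²)' are integrated by parts: they cancel the two b² x² |p|² terms
  -- and leave b ‖p‖².
  have h := gaussianIntegral_derivative hb (X * (q * p))
  rw [derivative_mul, derivative_mul, derivative_X, one_mul, mul_add, map_add, map_add] at h
  have e1 : (derivative q - C (b : ℂ) * (X * q)) * (derivative p - C (b : ℂ) * (X * p))
      = derivative q * derivative p - C (b : ℂ) * (X * (derivative q * p))
        - C (b : ℂ) * (X * (q * derivative p)) + C (b : ℂ) * (C (b : ℂ) * (X * (X * (q * p)))) := by
    ring
  have e2 : (C (b : ℂ) * (X * q)) * (C (b : ℂ) * (X * p))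
      = C (b : ℂ) * (C (b : ℂ) * (X * (X * (q * p)))) := by ring
  rw [e1, e2, map_add, map_sub, map_sub]
  simp only [gaussianIntegral_C_mul]
  linear_combination -(b : ℂ) * h

theorem eq_zero_of_gaussianNormSq_eq_zero {b : ℝ} (hb : 0 < b) {p : ℂ[X]}
    (h : gaussianNormSq b p = 0) : p = 0 := by
  have hc : Continuous fun x : ℝ => ‖p.eval (x : ℂ)‖ ^ 2 * Real.exp (-b * x ^ 2) := by
    have : Continuous fun x : ℝ => p.eval (x : ℂ) := p.continuous.comp Complex.continuous_ofReal
    fun_prop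
  rw [gaussianNormSq, integral_eq_zero_iff_of_nonneg (fun x => by positivity)
    (integrable_norm_sq_mul_gaussian hb p)] at h
  have h1 := (hc.ae_eq_iff_eq volume continuous_const).1 h
  refine p.eq_zero_of_infinite_isRoot ((Set.infinite_range_of_injective
    Complex.ofReal_injective).mono ?_)
  rintro _ ⟨x, rfl⟩
  have h2 : ‖p.eval (x : ℂ)‖ ^ 2 * Real.exp (-b * x ^ 2) = 0 := congrFun h1 x
  have h3 := (mul_eq_zero.1 h2).resolve_right (Real.exp_pos _).ne'
  exact norm_eq_zero.1 (pow_eq_zero_iff two_ne_zero |>.1 h3)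

/-- A polynomial times the ground state of the harmonic oscillator centred at `c`. -/
noncomputable def oscillatorFun (b c : ℝ) (p : ℂ[X]) (x : ℝ) : ℂ :=
  p.eval ((x - c : ℝ) : ℂ) * (Real.exp (-(b / 2) * (x - c) ^ 2) : ℂ)

theorem norm_sq_oscillatorFun (b c : ℝ) (p : ℂ[X]) (x : ℝ) :
    ‖oscillatorFun b c p x‖ ^ 2
      = ‖p.eval ((x - c : ℝ) : ℂ)‖ ^ 2 * Real.exp (-b * (x - c) ^ 2) := by
  rw [oscillatorFun, norm_mul, mul_pow, Complex.norm_real, Real.norm_of_nonneg (Real.exp_pos _).le,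
    ← Real.exp_nat_mul]
  congr 2
  push_cast; ring

theorem integral_norm_sq_oscillatorFun (b c : ℝ) (p : ℂ[X]) :
    ∫ x, ‖oscillatorFun b c p x‖ ^ 2 = gaussianNormSq b p := by
  simp_rw [norm_sq_oscillatorFun]
  exact integral_sub_right_eq_self (fun x : ℝ => ‖p.eval (x : ℂ)‖ ^ 2 * Real.exp (-b * x ^ 2)) c

theorem hasDerivAt_oscillatorFun (b c : ℝ) (p : ℂ[X]) (x : ℝ) :
    HasDerivAt (oscillatorFun b c p)
      (oscillatorFun b c (derivative p - C (b : ℂ) * (X * p)) x) x := by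
  have h1 := (hasDerivAt_eval_ofReal p (x - c)).comp_sub_const x c
  have h2 := (hasDerivAt_gaussian (b / 2) (x - c)).comp_sub_const x c
  convert! h1.mul h2 using 1
  simp only [oscillatorFun, eval_sub, eval_mul, eval_C, eval_X]
  push_cast
  ring

theorem deriv_oscillatorFun (b c : ℝ) (p : ℂ[X]) :
    deriv (oscillatorFun b c p) = oscillatorFun b c (derivative p - C (b : ℂ) * (X * p)) :=
  funext fun x => (hasDerivAt_oscillatorFun b c p x).deriv

theorem continuous_oscillatorFun (b c : ℝ) (p : ℂ[X]) : Continuous (oscillatorFun b c p) :=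
  continuous_iff_continuousAt.2 fun x => (hasDerivAt_oscillatorFun b c p x).continuousAt

theorem contDiff_oscillatorFun (b c : ℝ) (p : ℂ[X]) : ContDiff ℝ 1 (oscillatorFun b c p) := by
  rw [contDiff_one_iff_deriv, deriv_oscillatorFun]
  exact ⟨fun x => (hasDerivAt_oscillatorFun b c p x).differentiableAt,
    continuous_oscillatorFun b c _⟩

theorem memLp_oscillatorFun {b : ℝ} (hb : 0 < b) (c : ℝ) (p : ℂ[X]) :
    MemLp (oscillatorFun b c p) 2 volume := by
  rw [memLp_two_iff_integrable_sq_norm (continuous_oscillatorFun b c p).aestronglyMeasurable]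
  simp_rw [norm_sq_oscillatorFun]
  exact (integrable_norm_sq_mul_gaussian hb p).comp_sub_right c

theorem oscillatorFun_add (b c : ℝ) (p q : ℂ[X]) :
    oscillatorFun b c (p + q) = oscillatorFun b c p + oscillatorFun b c q := by
  ext x; simp [oscillatorFun, add_mul]

theorem oscillatorFun_smul (b c : ℝ) (k : ℂ) (p : ℂ[X]) :
    oscillatorFun b c (k • p) = k • oscillatorFun b c p := by
  ext x; simp [oscillatorFun, mul_assoc]

theorem norm_mul_oscillatorFun_le {a : C(ℝ, ℝ)} {b c : ℝ} (hb : 0 < b)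
    (ha : ∀ x, |a x| ≤ b * |x - c|) (p : ℂ[X]) (x : ℝ) :
    ‖(a x : ℂ) * oscillatorFun b c p x‖ ≤ ‖oscillatorFun b c (C (b : ℂ) * (X * p)) x‖ := by
  have e : oscillatorFun b c (C (b : ℂ) * (X * p)) x
      = ((b * (x - c) : ℝ) : ℂ) * oscillatorFun b c p x := by
    simp only [oscillatorFun, eval_mul, eval_C, eval_X]
    push_cast; ring
  rw [e, norm_mul, norm_mul, Complex.norm_real, Complex.norm_real, Real.norm_eq_abs,
    Real.norm_eq_abs, abs_mul, abs_of_pos hb]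
  gcongr
  exact ha x

theorem memLp_mul_oscillatorFun {a : C(ℝ, ℝ)} {b c : ℝ} (hb : 0 < b)
    (ha : ∀ x, |a x| ≤ b * |x - c|) (p : ℂ[X]) :
    MemLp (fun x => (a x : ℂ) * oscillatorFun b c p x) 2 volume :=
  (memLp_oscillatorFun hb c (C (b : ℂ) * (X * p))).mono
    ((Complex.continuous_ofReal.comp a.continuous).mul
      (continuous_oscillatorFun b c p)).aestronglyMeasurable
    (Filter.Eventually.of_forall fun x => norm_mul_oscillatorFun_le hb ha p x)

theorem norm_sq_toLp {f : ℝ → ℂ} (hf : MemLp f 2 volume) : ‖hf.toLp f‖ ^ 2 = ∫ x, ‖f x‖ ^ 2 := by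
  rw [norm_sq_L2R]
  exact integral_congr_ae (by filter_upwards [hf.coeFn_toLp] with x hx; rw [hx])

/-- The map sending a polynomial to the corresponding oscillator function in `L²(ℝ)`. -/
noncomputable def oscillatorLp {b : ℝ} (hb : 0 < b) (c : ℝ) : ℂ[X] →ₗ[ℂ] L2R where
  toFun p := (memLp_oscillatorFun hb c p).toLp _
  map_add' p q := by
    rw [← MemLp.toLp_add]
    simp_rw [oscillatorFun_add]
  map_smul' k p := by
    rw [RingHom.id_apply, ← MemLp.toLp_const_smul]
    simp_rw [oscillatorFun_smul]

theorem norm_sq_oscillatorLp {b : ℝ} (hb : 0 < b) (c : ℝ) (p : ℂ[X]) :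
    ‖oscillatorLp hb c p‖ ^ 2 = gaussianNormSq b p :=
  (norm_sq_toLp (memLp_oscillatorFun hb c p)).trans (integral_norm_sq_oscillatorFun b c p)

/-- The map sending a polynomial to `a` times the corresponding oscillator function. -/
noncomputable def mulOscillatorLp {a : C(ℝ, ℝ)} {b c : ℝ} (hb : 0 < b)
    (ha : ∀ x, |a x| ≤ b * |x - c|) : ℂ[X] →ₗ[ℂ] L2R where
  toFun p := (memLp_mul_oscillatorFun hb ha p).toLp _
  map_add' p q := by
    rw [← MemLp.toLp_add]
    congr 1
    ext x
    simp [oscillatorFun_add, mul_add]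
  map_smul' k p := by
    rw [RingHom.id_apply, ← MemLp.toLp_const_smul]
    congr 1
    ext x
    simp [oscillatorFun_smul, mul_left_comm]

theorem norm_sq_mulOscillatorLp_le {a : C(ℝ, ℝ)} {b c : ℝ} (hb : 0 < b)
    (ha : ∀ x, |a x| ≤ b * |x - c|) (p : ℂ[X]) :
    ‖mulOscillatorLp hb ha p‖ ^ 2 ≤ gaussianNormSq b (C (b : ℂ) * (X * p)) := by
  refine (norm_sq_toLp (memLp_mul_oscillatorFun hb ha p)).trans_le ?_
  rw [← integral_norm_sq_oscillatorFun b c]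
  refine integral_mono (memLp_mul_oscillatorFun hb ha p).norm.integrable_sq
    (memLp_oscillatorFun hb c _).norm.integrable_sq fun x => ?_
  have := norm_mul_oscillatorFun_le hb ha p x
  change ‖_‖ ^ 2 ≤ ‖_‖ ^ 2
  gcongr

/-- The map sending a polynomial to the corresponding element of the form domain. -/
noncomputable def oscillatorMap {a : C(ℝ, ℝ)} {b c : ℝ} (hb : 0 < b)
    (ha : ∀ x, |a x| ≤ b * |x - c|) : ℂ[X] →ₗ[ℂ] formDomain a where
  toFun p := ⟨WithLp.toLp 2 ![oscillatorLp hb c p,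
    oscillatorLp hb c (derivative p - C (b : ℂ) * (X * p)), mulOscillatorLp hb ha p],
    subset_closure ⟨oscillatorFun b c p, contDiff_oscillatorFun b c p,
      MemLp.coeFn_toLp (memLp_oscillatorFun hb c p), by
        rw [deriv_oscillatorFun]
        exact MemLp.coeFn_toLp (memLp_oscillatorFun hb c _),
      MemLp.coeFn_toLp (memLp_mul_oscillatorFun hb ha p)⟩⟩
  map_add' p q := by
    refine Subtype.ext (PiLp.ext fun i => ?_)
    fin_cases i
    · exact map_add (oscillatorLp hb c) p q
    · refine Eq.trans ?_ (map_add (oscillatorLp hb c) _ _)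
      refine congrArg (oscillatorLp hb c) ?_
      rw [derivative_add]; ring
    · exact map_add (mulOscillatorLp hb ha) p q
  map_smul' k p := by
    refine Subtype.ext (PiLp.ext fun i => ?_)
    fin_cases i
    · exact map_smul (oscillatorLp hb c) k p
    · refine Eq.trans ?_ (map_smul (oscillatorLp hb c) k _)
      refine congrArg (oscillatorLp hb c) ?_
      rw [derivative_smul, smul_sub, mul_smul_comm, mul_smul_comm]
    · exact map_smul (mulOscillatorLp hb ha) k p

/-- If `|a(x)| ≤ b |x - c|`, the Hermite functions span a trial space for the oscillator level. -/
theorem hasTrialSpace_oscillator {a : C(ℝ, ℝ)} {b c : ℝ} (hb : 0 < b)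
    (ha : ∀ x, |a x| ≤ b * |x - c|) {j : ℕ} (hj : 1 ≤ j) :
    HasTrialSpace a j ((2 * j - 1) * b) := by
  set Ψ := oscillatorMap hb ha ∘ₗ (degreeLT ℂ j).subtype with hΨ
  have hinj : Function.Injective Ψ := by
    rw [← LinearMap.ker_eq_bot, LinearMap.ker_eq_bot']
    intro p hp
    have h := norm_sq_oscillatorLp hb c (p : ℂ[X])
    have hp' : oscillatorMap hb ha (p : ℂ[X]) = 0 := hp
    have h0 : oscillatorLp hb c (p : ℂ[X]) = 0 := by
      change formEmbedding a (oscillatorMap hb ha (p : ℂ[X])) = 0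
      rw [hp', map_zero]
    rw [h0, norm_zero, zero_pow two_ne_zero] at h
    exact Subtype.ext (eq_zero_of_gaussianNormSq_eq_zero hb h.symm)
  refine ⟨LinearMap.range Ψ, ?_, ?_⟩
  · rw [LinearMap.finrank_range_of_inj hinj, (degreeLTEquiv ℂ j).finrank_eq, Module.finrank_fin_fun]
  · rintro _ ⟨⟨p, hp⟩, rfl⟩
    change ‖oscillatorMap hb ha p‖ ^ 2 ≤ _ * ‖formEmbedding a (oscillatorMap hb ha p)‖ ^ 2
    have h0 := norm_sq_oscillatorLp hb c p
    have h1 : ‖oscillatorMap hb ha p‖ ^ 2 = ‖oscillatorLp hb c p‖ ^ 2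
        + ‖oscillatorLp hb c (derivative p - C (b : ℂ) * (X * p))‖ ^ 2
        + ‖mulOscillatorLp hb ha p‖ ^ 2 := norm_sq_formSpace (oscillatorMap hb ha p : FormSpace)
    have h2 := norm_sq_oscillatorLp hb c (derivative p - C (b : ℂ) * (X * p))
    have h3 := norm_sq_mulOscillatorLp_le hb ha p
    have h4 := gaussianNormSq_oscillator hb p
    have hdeg : p.natDegree ≤ j - 1 := by
      rw [mem_degreeLT] at hp
      by_cases hp0 : p = 0
      · simp [hp0]
      · have := (natDegree_lt_iff_degree_lt hp0).2 hp
        omega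
    -- Degree at most j - 1 contributes 2(j - 1) b, and the zero-point energy adds b: in total (2j -
    -- 1) b.
    have h5 := gaussianNormSq_derivative_le hb (j - 1) p hdeg
    rw [Nat.cast_sub hj, Nat.cast_one] at h5
    have h6 : ‖formEmbedding a (oscillatorMap hb ha p)‖ ^ 2 = gaussianNormSq b p := h0
    rw [h6, h1, h0, h2]
    linarith

end GaussianTrialSpace

/-! ### Perturbation of the form and comparison of eigenvalues. -/

section Comparison

theorem norm_ofReal_mul_le {m : C(ℝ, ℝ)} {δ : ℝ} (hm : ∀ x, |m x| ≤ δ) (u : L2R) (x : ℝ) :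
    ‖(m x : ℂ) * u x‖ ≤ δ * ‖u x‖ := by
  rw [norm_mul, Complex.norm_real]
  exact mul_le_mul_of_nonneg_right (hm x) (norm_nonneg _)

theorem memLp_ofReal_mul {m : C(ℝ, ℝ)} {δ : ℝ} (hm : ∀ x, |m x| ≤ δ) (u : L2R) :
    MemLp (fun x => (m x : ℂ) * u x) 2 volume :=
  (Lp.memLp u).of_le_mul ((Complex.continuous_ofReal.comp m.continuous).aestronglyMeasurable.mul
    (Lp.aestronglyMeasurable u)) (Filter.Eventually.of_forall (norm_ofReal_mul_le hm u))

theorem norm_toLp_ofReal_mul_le {m : C(ℝ, ℝ)} {δ : ℝ} (hm : ∀ x, |m x| ≤ δ) (u : L2R) :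
    ‖(memLp_ofReal_mul hm u).toLp _‖ ≤ δ * ‖u‖ :=
  Lp.norm_le_mul_norm_of_ae_le_mul (by
    filter_upwards [(memLp_ofReal_mul hm u).coeFn_toLp] with x hx
    rw [hx]
    exact norm_ofReal_mul_le hm u x)

/-- The operator of multiplication by a bounded continuous real function on `L²(ℝ)`. -/
noncomputable def mulL2R (m : C(ℝ, ℝ)) {δ : ℝ} (hm : ∀ x, |m x| ≤ δ) : L2R →L[ℂ] L2R :=
  LinearMap.mkContinuous
    { toFun := fun u => (memLp_ofReal_mul hm u).toLp _
      map_add' := fun u v => by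
        rw [← MemLp.toLp_add]
        refine MemLp.toLp_congr _ _ ?_
        filter_upwards [Lp.coeFn_add u v] with x hx
        rw [hx, Pi.add_apply, Pi.add_apply, mul_add]
      map_smul' := fun c u => by
        rw [RingHom.id_apply, ← MemLp.toLp_const_smul]
        refine MemLp.toLp_congr _ _ ?_
        filter_upwards [Lp.coeFn_smul c u] with x hx
        rw [hx, Pi.smul_apply, Pi.smul_apply, smul_eq_mul, smul_eq_mul, mul_left_comm] }
    δ (norm_toLp_ofReal_mul_le hm)

theorem coeFn_mulL2R (m : C(ℝ, ℝ)) {δ : ℝ} (hm : ∀ x, |m x| ≤ δ) (u : L2R) :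
    mulL2R m hm u =ᵐ[volume] fun x => (m x : ℂ) * u x :=
  MemLp.coeFn_toLp (memLp_ofReal_mul hm u)

theorem norm_mulL2R_le (m : C(ℝ, ℝ)) {δ : ℝ} (hm : ∀ x, |m x| ≤ δ) (u : L2R) :
    ‖mulL2R m hm u‖ ≤ δ * ‖u‖ :=
  norm_toLp_ofReal_mul_le hm u

/-- The shear replaces a u by a' u. It is continuous and maps core to core, hence closure to
closure. -/
theorem shear_mem_formDomain {a a' : C(ℝ, ℝ)} {δ : ℝ} (h : ∀ x, |(a' - a) x| ≤ δ) {p : FormSpace}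
    (hp : p ∈ formDomain a) :
    WithLp.toLp 2 ![p 0, p 1, p 2 + mulL2R (a' - a) h (p 0)] ∈ formDomain a' := by
  have hc : Continuous fun p : FormSpace =>
      (WithLp.toLp 2 ![p 0, p 1, p 2 + mulL2R (a' - a) h (p 0)] : FormSpace) := by
    refine (PiLp.continuous_toLp 2 _).comp (continuous_pi fun i => ?_)
    fin_cases i
    · exact PiLp.continuous_apply 2 _ 0
    · exact PiLp.continuous_apply 2 _ 1
    · exact (PiLp.continuous_apply 2 _ 2).add
        ((mulL2R (a' - a) h).continuous.comp (PiLp.continuous_apply 2 _ 0))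
  refine map_mem_closure (f := fun p : FormSpace =>
    (WithLp.toLp 2 ![p 0, p 1, p 2 + mulL2R (a' - a) h (p 0)] : FormSpace)) hc hp ?_
  rintro q ⟨f, hf, f0, f1, f2⟩
  refine ⟨f, hf, f0, f1, ?_⟩
  change (q 2 + mulL2R (a' - a) h (q 0) : L2R) =ᵐ[volume] _
  filter_upwards [Lp.coeFn_add (q 2) (mulL2R (a' - a) h (q 0)), coeFn_mulL2R (a' - a) h (q 0),
    f0, f2] with x h1 h2 h3 h4
  rw [h1, Pi.add_apply, h2, h3, h4, ContinuousMap.sub_apply]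
  push_cast; ring

/-- The identification of the form domains of `a` and `a'` when `a' - a` is bounded. -/
noncomputable def formDomainShear {a a' : C(ℝ, ℝ)} {δ : ℝ} (h : ∀ x, |(a' - a) x| ≤ δ) :
    formDomain a →ₗ[ℂ] formDomain a' where
  toFun p := ⟨_, shear_mem_formDomain h p.2⟩
  map_add' p q := by
    refine Subtype.ext (PiLp.ext fun i => ?_)
    fin_cases i
    · rfl
    · rfl
    · change (p + q : FormSpace) 2 + mulL2R (a' - a) h ((p + q : FormSpace) 0)
        = ((p : FormSpace) 2 + mulL2R (a' - a) h ((p : FormSpace) 0))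
          + ((q : FormSpace) 2 + mulL2R (a' - a) h ((q : FormSpace) 0))
      rw [PiLp.add_apply, PiLp.add_apply, map_add]
      abel
  map_smul' c p := by
    refine Subtype.ext (PiLp.ext fun i => ?_)
    fin_cases i
    · rfl
    · rfl
    · change (c • p : FormSpace) 2 + mulL2R (a' - a) h ((c • p : FormSpace) 0)
        = c • ((p : FormSpace) 2 + mulL2R (a' - a) h ((p : FormSpace) 0))
      rw [PiLp.smul_apply, PiLp.smul_apply, map_smul, smul_add]

theorem formDomainShear_injective {a a' : C(ℝ, ℝ)} {δ : ℝ} (h : ∀ x, |(a' - a) x| ≤ δ) :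
    Function.Injective (formDomainShear h) := by
  intro p q hpq
  have hc : ∀ i, (formDomainShear h p : FormSpace) i = (formDomainShear h q : FormSpace) i :=
    fun i => by rw [hpq]
  have h0 : (p : FormSpace) 0 = (q : FormSpace) 0 := hc 0
  have h1 : (p : FormSpace) 1 = (q : FormSpace) 1 := hc 1
  have h2 : (p : FormSpace) 2 + mulL2R (a' - a) h ((p : FormSpace) 0)
      = (q : FormSpace) 2 + mulL2R (a' - a) h ((q : FormSpace) 0) := hc 2
  rw [h0] at h2
  refine Subtype.ext (PiLp.ext fun i => ?_)
  fin_cases i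
  · exact h0
  · exact h1
  · exact add_right_cancel h2

/-- A bounded perturbation of `a` by at most `δ` raises form bounds `E` to at most
`E + 2 δ √E + δ²`. -/
theorem HasTrialSpace.perturb {a a' : C(ℝ, ℝ)} {δ : ℝ} (hδ : 0 ≤ δ) (h : ∀ x, |(a' - a) x| ≤ δ)
    {j : ℕ} (hj : 1 ≤ j) {E : ℝ} (hE : HasTrialSpace a j E) :
    HasTrialSpace a' j (E + 2 * δ * √E + δ ^ 2) := by
  have hE0 := hE.nonneg hj
  obtain ⟨W, hW, hb⟩ := hE
  refine ⟨W.map (formDomainShear h), ?_, ?_⟩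
  · rw [← hW]
    exact (Submodule.equivMapOfInjective _ (formDomainShear_injective h) W).finrank_eq.symm
  · rintro _ ⟨p, hp, rfl⟩
    have h1 := hb p hp
    set u := (p : FormSpace) 0 with hu
    set w := (p : FormSpace) 1 with hw
    set z := (p : FormSpace) 2 with hz
    have e1 : ‖p‖ ^ 2 = ‖u‖ ^ 2 + ‖w‖ ^ 2 + ‖z‖ ^ 2 := norm_sq_formSpace (p : FormSpace)
    have e2 : ‖formDomainShear h p‖ ^ 2 = ‖u‖ ^ 2 + ‖w‖ ^ 2 + ‖z + mulL2R (a' - a) h u‖ ^ 2 :=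
      norm_sq_formSpace (formDomainShear h p : FormSpace)
    have e3 : formEmbedding a p = u := rfl
    have e4 : formEmbedding a' (formDomainShear h p) = u := rfl
    rw [e3, e1] at h1
    rw [e4, e2]
    -- Here `z` is a u, and ‖w‖² + ‖z‖² ≤ E ‖u‖²; dropping ‖w‖² bounds `z`, and the cross term 2 δ
    -- ‖u‖ ‖z‖ then produces 2 δ √E.
    have hzn : ‖z‖ ≤ √E * ‖u‖ := by
      refine le_of_sq_le_sq ?_ (by positivity)
      rw [mul_pow, Real.sq_sqrt hE0]
      nlinarith [sq_nonneg ‖w‖]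
    have h2 : ‖z + mulL2R (a' - a) h u‖ ≤ ‖z‖ + δ * ‖u‖ :=
      (norm_add_le _ _).trans (add_le_add_right (norm_mulL2R_le _ h u) _)
    have h3 : ‖z + mulL2R (a' - a) h u‖ ^ 2 ≤ (‖z‖ + δ * ‖u‖) ^ 2 := by gcongr
    have h4 : δ * ‖u‖ * ‖z‖ ≤ δ * ‖u‖ * (√E * ‖u‖) := by gcongr
    nlinarith

theorem nthEigenvalue_eq_sInf {a : C(ℝ, ℝ)} (ha : ∀ m : ℝ, ∃ R : ℝ, ∀ x, R ≤ |x| → m ≤ |a x|)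
    {j : ℕ} (hj : 1 ≤ j) :
    nthEigenvalue (schrodingerOp (a ^ 2)) j = sInf {E | HasTrialSpace a j E} := by
  refine congrArg sInf (Set.ext fun E => ?_)
  exact ⟨hasTrialSpace_of_hasEigenvectorsBelow hj,
    fun h => h.hasEigenvectorsBelow (isCompactOperator_formEmbedding ha) hj⟩

theorem nthEigenvalue_le_of_hasTrialSpace {a : C(ℝ, ℝ)}
    (ha : ∀ m : ℝ, ∃ R : ℝ, ∀ x, R ≤ |x| → m ≤ |a x|) {j : ℕ} (hj : 1 ≤ j) {E : ℝ}
    (hE : HasTrialSpace a j E) : nthEigenvalue (schrodingerOp (a ^ 2)) j ≤ E := by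
  rw [nthEigenvalue_eq_sInf ha hj]
  exact csInf_le ⟨0, fun E hE => hE.nonneg hj⟩ hE

/-- Comparison of the eigenvalues for two potentials `a²`, `a'²` with `|a' - a| ≤ δ`. -/
theorem nthEigenvalue_le_perturb {a a' : C(ℝ, ℝ)}
    (ha : ∀ m : ℝ, ∃ R : ℝ, ∀ x, R ≤ |x| → m ≤ |a x|)
    (ha' : ∀ m : ℝ, ∃ R : ℝ, ∀ x, R ≤ |x| → m ≤ |a' x|) {δ : ℝ} (hδ : 0 ≤ δ)
    (h : ∀ x, |(a' - a) x| ≤ δ) {j : ℕ} (hj : 1 ≤ j) {B : ℝ} (hB : HasTrialSpace a j B) :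
    nthEigenvalue (schrodingerOp (a' ^ 2)) j
      ≤ nthEigenvalue (schrodingerOp (a ^ 2)) j + 2 * δ * √B + δ ^ 2 := by
  -- The infimum is not known to be attained; the inequality holds for each admissible `E` and is
  -- closed in `E`, so it passes to the infimum.
  have hcl : IsClosed {E : ℝ | nthEigenvalue (schrodingerOp (a' ^ 2)) j
      ≤ E + 2 * δ * √E + δ ^ 2} := isClosed_le (by fun_prop) (by fun_prop)
  have hmem : sInf {E | HasTrialSpace a j E} ∈ closure {E | HasTrialSpace a j E} :=
    csInf_mem_closure ⟨B, hB⟩ ⟨0, fun E hE => hE.nonneg hj⟩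
  have key := closure_minimal (fun E (hE : HasTrialSpace a j E) =>
    nthEigenvalue_le_of_hasTrialSpace ha' hj (hE.perturb hδ h hj)) hcl hmem
  rw [← nthEigenvalue_eq_sInf ha hj] at key
  refine le_trans key ?_
  gcongr
  exact nthEigenvalue_le_of_hasTrialSpace ha hj hB

/-! ### Estimates for the magnetic potentials. -/

theorem vectorPotential_apply (b : ℝ → ℝ) (hb : LocallyIntegrable b volume) (x : ℝ) :
    vectorPotential b hb x = ∫ s in (0 : ℝ)..x, b s := rfl

theorem intervalIntegrable_of_locallyIntegrable {b : ℝ → ℝ} (hb : LocallyIntegrable b volume)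
    (x y : ℝ) : IntervalIntegrable b volume x y :=
  (hb.integrableOn_isCompact isCompact_uIcc).intervalIntegrable

theorem vectorPotential_sub (b : ℝ → ℝ) (hb : LocallyIntegrable b volume) (x y : ℝ) :
    vectorPotential b hb y - vectorPotential b hb x = ∫ s in x..y, b s := by
  rw [vectorPotential_apply, vectorPotential_apply]
  exact intervalIntegral.integral_interval_sub_left (intervalIntegrable_of_locallyIntegrable hb _ _)
    (intervalIntegrable_of_locallyIntegrable hb _ _)

theorem vectorPotential_sub_mem_Icc {b : ℝ → ℝ} (hb : LocallyIntegrable b volume) {bm bp : ℝ}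
    (h : ∀ᵐ x, bm ≤ b x ∧ b x ≤ bp) {x y : ℝ} (hxy : x ≤ y) :
    bm * (y - x) ≤ vectorPotential b hb y - vectorPotential b hb x ∧
      vectorPotential b hb y - vectorPotential b hb x ≤ bp * (y - x) := by
  rw [vectorPotential_sub]
  have hi := intervalIntegrable_of_locallyIntegrable hb x y
  constructor
  · have := intervalIntegral.integral_mono_ae hxy intervalIntegrable_const hi
      (h.mono fun x hx => hx.1)
    rw [intervalIntegral.integral_const, smul_eq_mul] at this
    linarith
  · have := intervalIntegral.integral_mono_ae hxy hi intervalIntegrable_const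
      (h.mono fun x hx => hx.2)
    rw [intervalIntegral.integral_const, smul_eq_mul] at this
    linarith

theorem abs_vectorPotential_sub {b : ℝ → ℝ} (hb : LocallyIntegrable b volume) {bm bp : ℝ}
    (hbm : 0 < bm) (h : ∀ᵐ x, bm ≤ b x ∧ b x ≤ bp) (x y : ℝ) :
    bm * |y - x| ≤ |vectorPotential b hb y - vectorPotential b hb x| ∧
      |vectorPotential b hb y - vectorPotential b hb x| ≤ bp * |y - x| := by
  wlog hxy : x ≤ y generalizing x y
  · rw [abs_sub_comm y x, abs_sub_comm (vectorPotential b hb y)]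
    exact this y x (le_of_not_ge hxy)
  · obtain ⟨h1, h2⟩ := vectorPotential_sub_mem_Icc hb h hxy
    have h3 : 0 ≤ bm * (y - x) := mul_nonneg hbm.le (by linarith)
    rw [abs_of_nonneg (by linarith : 0 ≤ y - x), abs_of_nonneg (h3.trans h1)]
    exact ⟨h1, h2⟩

theorem fiberPotential_tendsto {b : ℝ → ℝ} (hb : LocallyIntegrable b volume) {bm bp : ℝ}
    (hbm : 0 < bm) (h : ∀ᵐ x, bm ≤ b x ∧ b x ≤ bp) (k m : ℝ) :
    ∃ R : ℝ, ∀ x, R ≤ |x| → m ≤ |(ContinuousMap.const ℝ k - vectorPotential b hb) x| := by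
  refine ⟨(m + |k|) / bm, fun x hx => ?_⟩
  rw [div_le_iff₀ hbm] at hx
  have h1 := (abs_vectorPotential_sub hb hbm h 0 x).1
  have h0 : vectorPotential b hb 0 = 0 := by
    rw [vectorPotential_apply, intervalIntegral.integral_same]
  rw [h0, sub_zero, sub_zero] at h1
  rw [ContinuousMap.sub_apply, ContinuousMap.const_apply, abs_sub_comm]
  have := abs_sub_abs_le_abs_sub (vectorPotential b hb x) k
  linarith

/-- Intermediate value theorem between ±|k|/b₋. The point `c` becomes the centre of the comparison
oscillator. -/
theorem exists_vectorPotential_eq {b : ℝ → ℝ} (hb : LocallyIntegrable b volume) {bm bp : ℝ}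
    (hbm : 0 < bm) (h : ∀ᵐ x, bm ≤ b x ∧ b x ≤ bp) (k : ℝ) :
    ∃ c, vectorPotential b hb c = k := by
  have h0 : vectorPotential b hb 0 = 0 := by
    rw [vectorPotential_apply, intervalIntegral.integral_same]
  have hk : 0 ≤ |k| / bm := by positivity
  have h1 := (vectorPotential_sub_mem_Icc hb h hk).1
  have h2 := (vectorPotential_sub_mem_Icc hb h (neg_nonpos.2 hk)).1
  have e : bm * (|k| / bm) = |k| := by field_simp
  rw [h0, sub_zero, sub_zero, e] at h1
  rw [h0, zero_sub, zero_sub, neg_neg, e] at h2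
  exact mem_range_of_exists_le_of_exists_ge (vectorPotential b hb).continuous
    ⟨-(|k| / bm), by linarith [neg_abs_le k]⟩ ⟨|k| / bm, (le_abs_self k).trans h1⟩

theorem hasTrialSpace_fiber {b : ℝ → ℝ} (hb : LocallyIntegrable b volume) {bm bp : ℝ}
    (hbm : 0 < bm) (hbp : 0 < bp) (h : ∀ᵐ x, bm ≤ b x ∧ b x ≤ bp) (k : ℝ) {j : ℕ} (hj : 1 ≤ j) :
    HasTrialSpace (ContinuousMap.const ℝ k - vectorPotential b hb) j ((2 * j - 1) * bp) := by
  obtain ⟨c, hc⟩ := exists_vectorPotential_eq hb hbm h k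
  refine hasTrialSpace_oscillator (c := c) hbp (fun x => ?_) hj
  rw [ContinuousMap.sub_apply, ContinuousMap.const_apply, ← hc, abs_sub_comm]
  exact (abs_vectorPotential_sub hb hbm h c x).2

/-- The primitive of a function supported in `[-ε, ε]` and bounded by `D`. -/
theorem abs_integral_le_of_ae_supported {g : ℝ → ℝ} {D ε : ℝ} (hD : 0 ≤ D) (hε : 0 < ε)
    (hi : LocallyIntegrable g volume) (hle : ∀ᵐ t, |g t| ≤ D) (h0 : ∀ᵐ t, ε < |t| → g t = 0)
    (x : ℝ) : |∫ t in (0 : ℝ)..x, g t| ≤ D * ε := by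
  -- `c` is `x` clamped to [-ε, ε]; the integral from `c` to `x` vanishes.
  set c := max (-ε) (min x ε) with hc
  have hcε : |c| ≤ ε := by
    rw [abs_le]
    exact ⟨le_max_left _ _, max_le (by linarith) (min_le_right _ _)⟩
  have h1 : ‖∫ t in (0 : ℝ)..c, g t‖ ≤ D * |c - 0| :=
    intervalIntegral.norm_integral_le_of_norm_le_const_ae (hle.mono fun t ht _ => ht)
  have h2 : ‖∫ t in c..x, g t‖ ≤ 0 * |x - c| := by
    refine intervalIntegral.norm_integral_le_of_norm_le_const_ae ?_
    -- For x < -ε the half-open interval contains its endpoint -ε, where `g` is not controlled by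
    -- `h0`; this null point is discarded.
    filter_upwards [h0, Measure.ae_ne volume (-ε)] with t ht hne htm
    rw [ht, norm_zero]
    rcases Set.mem_uIoc.1 htm with ⟨h3, h4⟩ | ⟨h3, h4⟩
    · have h5 : min x ε < t := (le_max_right _ _).trans_lt h3
      have h6 : ε < t := by
        rcases min_lt_iff.1 h5 with h | h
        · exact absurd h4 (not_le.2 h)
        · exact h
      exact h6.trans_le (le_abs_self t)
    · have h5 : t ≤ -ε := by
        rcases le_max_iff.1 h4 with h | h
        · exact h
        · exact absurd (h.trans (min_le_left _ _)) (not_le.2 h3)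
      have h6 : t < -ε := lt_of_le_of_ne h5 hne
      exact (by linarith : ε < -t).trans_le (neg_le_abs t)
  rw [← intervalIntegral.integral_add_adjacent_intervals
    (intervalIntegrable_of_locallyIntegrable hi 0 c) (intervalIntegrable_of_locallyIntegrable hi c x)]
  rw [Real.norm_eq_abs, sub_zero] at h1
  rw [Real.norm_eq_abs, zero_mul] at h2
  refine (abs_add_le _ _).trans ?_
  nlinarith

theorem sharpField_mem_Icc {bm bp : ℝ} (h : bm ≤ bp) (x : ℝ) :
    bm ≤ sharpField bm bp x ∧ sharpField bm bp x ≤ bp := by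
  unfold sharpField
  split_ifs
  · exact ⟨le_rfl, h⟩
  · exact ⟨h, le_rfl⟩

theorem IsSmoothedField.mem_Icc {bm bp ε : ℝ} (h : bm ≤ bp) {b : ℝ → ℝ}
    (hb : IsSmoothedField bm bp ε b) : ∀ᵐ x, bm ≤ b x ∧ b x ≤ bp := by
  obtain ⟨h1, h2, h3⟩ := hb
  filter_upwards [h1, h2, h3] with x h1 h2 h3
  by_cases hx : |x| ≤ ε
  · exact h3 hx
  · rcases lt_abs.1 (not_le.1 hx) with h' | h'
    · rw [h2 h']; exact ⟨h, le_rfl⟩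
    · rw [h1 (by linarith)]; exact ⟨le_rfl, h⟩

/-- Both fields take values in [b₋, b₊] and agree off [-ε, ε] almost everywhere. Integration starts
at 0 and meets only half of that interval, hence ε and not 2ε. -/
theorem IsSmoothedField.abs_vectorPotential_sub_le {bm bp ε : ℝ} (h : bm ≤ bp) (hε : 0 < ε)
    {b : ℝ → ℝ} (hloc : LocallyIntegrable b volume) (hb : IsSmoothedField bm bp ε b) (x : ℝ) :
    |vectorPotential b hloc x
      - vectorPotential (sharpField bm bp) (locallyIntegrable_sharpField bm bp) x|
      ≤ (bp - bm) * ε := by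
  have hs := locallyIntegrable_sharpField bm bp
  rw [vectorPotential_apply, vectorPotential_apply,
    ← intervalIntegral.integral_sub (intervalIntegrable_of_locallyIntegrable hloc _ _)
      (intervalIntegrable_of_locallyIntegrable hs _ _)]
  refine abs_integral_le_of_ae_supported (by linarith) hε (hloc.sub hs) ?_ ?_ x
  · filter_upwards [hb.mem_Icc h] with t ht
    have := sharpField_mem_Icc h t
    rw [Pi.sub_apply, abs_le]
    constructor <;> linarith [this.1, this.2, ht.1, ht.2]
  · filter_upwards [hb.1, hb.2.1] with t h1 h2 ht
    rw [Pi.sub_apply]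
    rcases lt_abs.1 ht with h' | h'
    · rw [h2 h', sharpField, if_neg (by linarith), sub_self]
    · rw [h1 (by linarith), sharpField, if_pos (by linarith), sub_self]

end Comparison

/-! ### The eigenvalue estimate. -/

theorem lemma5p1 (bm bp r ε : ℝ) (hbm : 0 < bm) (hbp : bm < bp) (hr : r = bp / bm) (hε : 0 < ε)
    (bε : ℝ → ℝ) (hloc : LocallyIntegrable bε volume) (hbε : IsSmoothedField bm bp ε bε)
    (j : ℕ) (hj : 1 ≤ j) (k : ℝ) :
    |bandFunction bε hloc j k
        - bandFunction (sharpField bm bp) (locallyIntegrable_sharpField bm bp) j k|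
      ≤ (r - 1) * (√bm * ε) * ((r - 1) * (√bm * ε) + 2 * √(2 * (j : ℝ) - 1) * √r) * bm := by
  have hbp0 : 0 < bp := hbm.trans hbp
  have hs := locallyIntegrable_sharpField bm bp
  have hIs : ∀ᵐ x, bm ≤ sharpField bm bp x ∧ sharpField bm bp x ≤ bp :=
    Filter.Eventually.of_forall (sharpField_mem_Icc hbp.le)
  have hIε := hbε.mem_Icc hbp.le
  have hj1 : (1 : ℝ) ≤ j := by exact_mod_cast hj
  have hδ : 0 ≤ (bp - bm) * ε := mul_nonneg (by linarith) hε.le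
  have hd := hbε.abs_vectorPotential_sub_le hbp.le hε hloc
  -- The a priori bound (2j - 1) b₊ holds for either field, so the two one-sided estimates have the
  -- same error.
  have h1 : bandFunction bε hloc j k ≤ bandFunction (sharpField bm bp) hs j k
      + 2 * ((bp - bm) * ε) * √((2 * j - 1) * bp) + ((bp - bm) * ε) ^ 2 :=
    nthEigenvalue_le_perturb (fiberPotential_tendsto hs hbm hIs k)
      (fiberPotential_tendsto hloc hbm hIε k) hδ
      (fun x => by simpa [abs_sub_comm] using hd x) hj (hasTrialSpace_fiber hs hbm hbp0 hIs k hj)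
  have h2 : bandFunction (sharpField bm bp) hs j k ≤ bandFunction bε hloc j k
      + 2 * ((bp - bm) * ε) * √((2 * j - 1) * bp) + ((bp - bm) * ε) ^ 2 :=
    nthEigenvalue_le_perturb (fiberPotential_tendsto hloc hbm hIε k)
      (fiberPotential_tendsto hs hbm hIs k) hδ
      (fun x => by simpa using hd x) hj (hasTrialSpace_fiber hloc hbm hbp0 hIε k hj)
  -- Substitute δ = (r - 1) b₋ ε and B = (2j - 1) r b₋ in 2 δ √B + δ².
  have e : (r - 1) * (√bm * ε) * ((r - 1) * (√bm * ε) + 2 * √(2 * (j : ℝ) - 1) * √r) * bm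
      = 2 * ((bp - bm) * ε) * √((2 * j - 1) * bp) + ((bp - bm) * ε) ^ 2 := by
    rw [hr, Real.sqrt_mul (by linarith), Real.sqrt_div hbp0.le]
    have hsp : 0 < √bm := Real.sqrt_pos.2 hbm
    have hsq : bm = √bm ^ 2 := (Real.sq_sqrt hbm.le).symm
    set s := √bm
    rw [hsq]
    field_simp
    ring
  rw [e, abs_le]
  constructor <;> linarith
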